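/- **Theorem.** All Riemann surfaces below are connected and compact, and $\mathbb{CP}^1$ is the Riemann sphere. Let $f\colon C_1\to\mathbb{CP}^1$ and $g\colon C_2\to\mathbb{CP}^1$ be nonconstant holomorphic maps on Riemann surfaces $C_1,C_2$, with $\deg f>1$. Let $S\subset\mathbb{CP}^1$ be the (finite) union of the sets of branch points (critical values) of $f$ and $g$, let $z_0\in\mathbb{CP}^1\setminus S$, and let $o(f,g)$ be the number of orbits of the diagonal monodromy action (by lifting loops) of $\pi_1(\mathbb{CP}^1\setminus S,z_0)$ on $f^{-1}\{z_0\}\times g^{-1}\{z_0\}$; this number does not depend on $z_0$. Suppose that the pair $f,g$ is irreducible, that is, $o(f,g)=1$. Let $p\colon C\to C_1$ and $q\colon C\to C_2$ be nonconstant holomorphic maps on a Riemann surface $C$ such that $f\circ p=g\circ q$. If $q$ is indecomposable, then $f$ is also indecomposable. Here a holomorphic map $F\colon X\to Y$ of degree greater than one between Riemann surfaces is called indecomposable if, whenever $F=a\circ b$ with holomorphic maps $b\colon X\to R$ and $a\colon R\to Y$ through a Riemann surface $R$, at least one of $a,b$ has degree one. -/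

import Mathlib

universe u v

namespace Decomposition

open Set Filter Topology OnePoint
open scoped Manifold ContDiff



/-! ### Compact Riemann surfaces -/

/-- A connected compact Riemann surface: a connected compact Hausdorff space with a complex
analytic atlas of charts with values in `ℂ`. -/
class CompactRiemannSurface (X : Type u) [TopologicalSpace X] [ChartedSpace ℂ X] : Prop
    extends T2Space X, CompactSpace X, ConnectedSpace X, IsManifold 𝓘(ℂ) ω X

/-! ### The Riemann sphere `ℂℙ¹ = ℂ ∪ {∞}` -/

/-- The standard chart `z ↦ z` of the Riemann sphere, defined off `∞`. -/
noncomputable def finiteChart : OpenPartialHomeomorph (OnePoint ℂ) ℂ :=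
  (isOpenEmbedding_coe (X := ℂ)).toOpenPartialHomeomorph.symm

/-- The chart `z ↦ 1 / z` of the Riemann sphere, defined off `0` and sending `∞` to `0`. -/
noncomputable def inftyChart : OpenPartialHomeomorph (OnePoint ℂ) ℂ where
  toFun x := x.elim 0 fun z => z⁻¹
  invFun w := open Classical in if w = 0 then ∞ else ((w⁻¹ : ℂ) : OnePoint ℂ)
  source := {((0 : ℂ) : OnePoint ℂ)}ᶜ
  target := univ
  map_source' _ _ := mem_univ _
  map_target' w _ := by
    by_cases hw : w = 0
    · simp [hw]
    · simp [hw]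
  left_inv' x hx := by
    induction x using OnePoint.rec with
    | infty => simp
    | coe z =>
      have hz : z ≠ 0 := fun h => hx (by simp [h])
      simp [hz]
  right_inv' w _ := by
    by_cases hw : w = 0
    · simp [hw]
    · simp [hw]
  open_source := isOpen_compl_singleton
  open_target := isOpen_univ
  continuousOn_toFun := by
    intro x hx
    apply ContinuousAt.continuousWithinAt
    induction x using OnePoint.rec with
    | infty =>
      rw [OnePoint.continuousAt_infty', coclosedCompact_eq_cocompact,
        ← Metric.cobounded_eq_cocompact]
      exact tendsto_inv₀_cobounded
    | coe z =>
      have hz : z ≠ 0 := fun h => hx (by simp [h])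
      rw [OnePoint.continuousAt_coe]
      exact continuousAt_inv₀ hz
  continuousOn_invFun := by
    classical
    intro w _
    apply ContinuousAt.continuousWithinAt
    by_cases hw : w = 0
    · subst hw
      have h : Tendsto (fun w : ℂ => ((w⁻¹ : ℂ) : OnePoint ℂ)) (𝓝[≠] 0) (𝓝 ∞) := by
        have h1 : Tendsto ((↑) : ℂ → OnePoint ℂ) (Bornology.cobounded ℂ) (𝓝 ∞) := by
          rw [Metric.cobounded_eq_cocompact, ← coclosedCompact_eq_cocompact]
          exact OnePoint.tendsto_coe_infty
        exact h1.comp tendsto_inv₀_nhdsNE_zero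
      rw [continuousAt_iff_punctured_nhds]
      simp only [if_true]
      refine h.congr' ?_
      filter_upwards [self_mem_nhdsWithin] with w hw
      have hw' : w ≠ 0 := hw
      simp [hw']
    · have h : ContinuousAt (fun w : ℂ => ((w⁻¹ : ℂ) : OnePoint ℂ)) w :=
        OnePoint.continuous_coe.continuousAt.comp (continuousAt_inv₀ hw)
      refine h.congr ?_
      filter_upwards [isOpen_compl_singleton.mem_nhds hw] with y hy
      have hy' : y ≠ 0 := hy
      simp [hy']

theorem finiteChart_coe (z : ℂ) : finiteChart (z : OnePoint ℂ) = z :=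
  (isOpenEmbedding_coe (X := ℂ)).toOpenPartialHomeomorph_left_inv

theorem finiteChart_symm_apply (z : ℂ) : finiteChart.symm z = (z : OnePoint ℂ) := rfl

theorem inftyChart_coe (z : ℂ) : inftyChart (z : OnePoint ℂ) = z⁻¹ := rfl

theorem inftyChart_infty : inftyChart OnePoint.infty = 0 := rfl

theorem inftyChart_symm_apply {w : ℂ} (hw : w ≠ 0) :
    inftyChart.symm w = ((w⁻¹ : ℂ) : OnePoint ℂ) :=
  if_neg hw

open Classical in
noncomputable instance : ChartedSpace ℂ (OnePoint ℂ) where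
  atlas := {finiteChart, inftyChart}
  chartAt x := if x = OnePoint.infty then inftyChart else finiteChart
  mem_chart_source x := by
    by_cases hx : x = OnePoint.infty
    · subst hx; simp [inftyChart]
    · rw [if_neg hx]
      obtain ⟨z, rfl⟩ := OnePoint.ne_infty_iff_exists.1 hx
      simp [finiteChart]
  chart_mem_atlas x := by
    by_cases hx : x = OnePoint.infty <;> simp [hx]

instance : IsManifold 𝓘(ℂ) ω (OnePoint ℂ) := by
  apply isManifold_of_contDiffOn
  rintro e e' (rfl | rfl) (rfl | rfl)
  · apply contDiffOn_id.congr
    intro z _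
    simp [finiteChart_symm_apply, finiteChart_coe]
  · intro z hz
    have hz0 : z ≠ 0 := by
      rintro rfl
      simp [finiteChart, inftyChart] at hz
    refine (contDiffAt_inv ℂ hz0).contDiffWithinAt.congr_of_mem ?_ hz
    intro y _
    simp [finiteChart_symm_apply, inftyChart_coe]
  · intro z hz
    have hz0 : z ≠ 0 := by
      rintro rfl
      simp [finiteChart, inftyChart] at hz
    refine (contDiffAt_inv ℂ hz0).contDiffWithinAt.congr_of_mem ?_ hz
    intro y hy
    have hy0 : y ≠ 0 := by
      rintro rfl
      simp [finiteChart, inftyChart] at hy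
    simp [inftyChart_symm_apply hy0, finiteChart_coe]
  · apply contDiffOn_id.congr
    intro z hz
    simpa using inftyChart.right_inv (mem_univ z)

instance : CompactRiemannSurface (OnePoint ℂ) where

/-! ### Holomorphic functions, degree, indecomposability -/

section Maps

variable {X : Type u} [TopologicalSpace X] [ChartedSpace ℂ X]
  {Y : Type v} [TopologicalSpace Y] [ChartedSpace ℂ Y]

/-- `f` is a nonconstant holomorphic map. -/
structure IsNonconstantHolomorphic (f : X → Y) : Prop where
  mdifferentiable : MDifferentiable 𝓘(ℂ) 𝓘(ℂ) f
  nonconstant : ¬ ∃ y, ∀ x, f x = y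

/-- The degree of a holomorphic map between connected compact Riemann surfaces: the number of
points in a generic fibre, which is the largest number of points in a fibre. It is `0` for a
constant map. -/
noncomputable def degree (f : X → Y) : ℕ := ⨆ y, (f ⁻¹' {y}).ncard

/-- A map of degree greater than one is indecomposable if in each of its factorizations `f = a ∘ b`
into holomorphic maps through a connected compact Riemann surface at least one of the factors has
degree one. -/
structure IsIndecomposable (f : X → Y) : Prop where
  one_lt_degree : 1 < degree f
  degree_eq_one : ∀ (R : Type u) [TopologicalSpace R] [ChartedSpace ℂ R] [CompactRiemannSurface R]
    (a : R → Y) (b : X → R), IsNonconstantHolomorphic a → IsNonconstantHolomorphic b →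
      f = a ∘ b → degree a = 1 ∨ degree b = 1

/-- The branch points of `f`: the images of the points where the derivative vanishes. -/
def branchPoints (f : X → Y) : Set Y :=
  {y | ∃ x, f x = y ∧ mfderiv 𝓘(ℂ) 𝓘(ℂ) f x = 0}

end Maps

/-! ### Monodromy and irreducible pairs -/

/-- Lifting the loop `γ` through `f` carries `a` to `a'`: some lift of `γ` starts at `a` and ends
at `a'`. -/
def MonodromySends {X Z : Type*} [TopologicalSpace X] [TopologicalSpace Z] (f : X → Z) {z₀ : Z}
    (γ : Path z₀ z₀) (a a' : f ⁻¹' {z₀}) : Prop :=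
  ∃ α : Path (a : X) (a' : X), ∀ t, f (α t) = γ t

/-- The orbit relation of the simultaneous monodromy action of the loops in `Z \ S` based at `z₀`
on the product of the fibres of `f` and `g` over `z₀`. -/
def pairMonodromy {X Y Z : Type*} [TopologicalSpace X] [TopologicalSpace Y] [TopologicalSpace Z]
    (f : X → Z) (g : Y → Z) (S : Set Z) {z₀ : Z} (hz₀ : z₀ ∉ S) :
    Setoid ((f ⁻¹' {z₀}) × (g ⁻¹' {z₀})) where
  r c c' := ∃ γ : Path z₀ z₀, (∀ t, γ t ∉ S) ∧
    MonodromySends f γ c.1 c'.1 ∧ MonodromySends g γ c.2 c'.2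
  iseqv :=
    { refl := fun c => ⟨Path.refl z₀, fun _ => hz₀,
        ⟨Path.refl _, fun _ => c.1.2⟩, ⟨Path.refl _, fun _ => c.2.2⟩⟩
      symm := by
        rintro c c' ⟨γ, hγ, ⟨α, hα⟩, ⟨β, hβ⟩⟩
        exact ⟨γ.symm, fun t => hγ _, ⟨α.symm, fun t => hα _⟩, ⟨β.symm, fun t => hβ _⟩⟩
      trans := by
        rintro c c' c'' ⟨γ, hγ, ⟨α, hα⟩, ⟨β, hβ⟩⟩ ⟨γ', hγ', ⟨α', hα'⟩, ⟨β', hβ'⟩⟩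
        refine ⟨γ.trans γ', fun t => ?_, ⟨α.trans α', fun t => ?_⟩, ⟨β.trans β', fun t => ?_⟩⟩
        · rw [Path.trans_apply]; split_ifs
          exacts [hγ _, hγ' _]
        · rw [Path.trans_apply, Path.trans_apply]; split_ifs
          exacts [hα _, hα' _]
        · rw [Path.trans_apply, Path.trans_apply]; split_ifs
          exacts [hβ _, hβ' _] }

/-- The number `o(f, g)` of orbits of the simultaneous monodromy action on pairs of points of the
fibres over the base point. -/
noncomputable def orbitCount {X Y Z : Type*} [TopologicalSpace X] [TopologicalSpace Y]
    [TopologicalSpace Z] (f : X → Z) (g : Y → Z) (S : Set Z) {z₀ : Z} (hz₀ : z₀ ∉ S) : ℕ :=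
  Nat.card (Quotient (pairMonodromy f g S hz₀))

/-- The pair `f`, `g` is irreducible if `o(f, g) = 1`, where `S` is the union of the sets of branch
points of `f` and `g` and `z₀` is a base point off `S` (the number does not depend on it). -/
def IsIrreduciblePair {X Y Z : Type*} [TopologicalSpace X] [ChartedSpace ℂ X]
    [TopologicalSpace Y] [ChartedSpace ℂ Y] [TopologicalSpace Z] [ChartedSpace ℂ Z]
    (f : X → Z) (g : Y → Z) : Prop :=
  ∃ (z₀ : Z) (hz₀ : z₀ ∉ branchPoints f ∪ branchPoints g),
    orbitCount f g (branchPoints f ∪ branchPoints g) hz₀ = 1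

end Decomposition

/-!
Let `f = a ∘ b` with `b : C₁ → R` and `a : R → ℂℙ¹`. Since `q` is indecomposable, it factors only
trivially through the normalization `E` of the image of `(q, b ∘ p) : C → C₂ × R`, which lies in
the fibre product of `g` and `a`. So one of the maps `C → E`, `E → C₂` has degree one, that is, is
injective.

Irreducibility of the pair `f`, `g` says that `(p, q)` hits every point of the fibre product of
`f` and `g` over the base point `z₀` (`exists_preimage_of_orbitCount_eq_one`). If `E → C₂` is
injective, then `b (p c)` is determined by `q c`, so the fibre of `a` over `z₀` is a single point.
If `C → E` is injective, then two points `x`, `x'` of `C₁` over `z₀` with `b x = b x'` lift to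
points of `C` with the same image in `E`, so `x = x'`, and `b` has a fibre with a single point. As
`z₀` is not a branch point of `f = a ∘ b`, these points are unramified, and a holomorphic map with
a fibre that consists of one unramified point is injective
(`IsNonconstantHolomorphic.injective_of_subsingleton_fiber`).

The surface `E` is constructed as a quotient of `C`: two points are identified if they are limits
of points with the same images under `q` and `b ∘ p` that are unramified for `a`
(`IsBranchedSquare.setoid`). The quotient is compact and connected because `C` is. Continuation
along paths in punctured discs (`IsBranchedSquare.continuation`) shows that this is an equivalence
relation with an open quotient map, and the relation is closed, so the quotient is Hausdorff. In a
disc with coordinate `t` where `q` is `t ↦ t ^ n`, the relation is `t ^ k = t' ^ k` for a divisor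
`k` of `n` (`IsBranchedSquare.exists_pow_eq_iff`), and `t ^ k` is a chart of `E`. Its `(n / k)`-th
power is a coordinate of `C₂` composed with the projection, and a continuous root of a holomorphic
function is holomorphic, so such charts are compatible and all maps in sight are holomorphic
(`isManifold_rootChartedSpace`).
-/

namespace Decomposition

open Set Filter Topology OnePoint
open scoped Manifold ContDiff

/-! ### Roots and local normal forms of holomorphic functions -/

theorem differentiableAt_of_pow_of_ne_zero {T F : ℂ → ℂ} {w : ℂ} {m : ℕ} (hm : m ≠ 0)
    (hT : ContinuousAt T w) (hF : DifferentiableAt ℂ F w)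
    (h : ∀ᶠ v in 𝓝 w, T v ^ m = F v) (h0 : T w ≠ 0) : DifferentiableAt ℂ T w := by
  have hs : HasStrictDerivAt (fun u : ℂ => u ^ m) (m * T w ^ (m - 1)) (T w) :=
    hasStrictDerivAt_pow m (T w)
  have hne : (m * T w ^ (m - 1) : ℂ) ≠ 0 :=
    mul_ne_zero (Nat.cast_ne_zero.2 hm) (pow_ne_zero _ h0)
  have hP := hs.to_localInverse hne
  have hleft := (hs.hasStrictFDerivAt_equiv hne).eventually_left_inverse
  have hev : T =ᶠ[𝓝 w] (hs.localInverse _ _ _ hne) ∘ F := by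
    filter_upwards [hT.eventually hleft, h] with v hv hv'
    rw [Function.comp_apply, ← hv']
    exact hv.symm
  refine DifferentiableAt.congr_of_eventuallyEq ?_ hev
  refine DifferentiableAt.comp w ?_ hF
  rw [← h.self_of_nhds]
  exact hP.hasDerivAt.differentiableAt

/-- A continuous root of a holomorphic function is holomorphic, also at its zeros. -/
theorem differentiableAt_of_pow {T F : ℂ → ℂ} {w : ℂ} {m : ℕ} (hm : m ≠ 0)
    (hT : ∀ᶠ v in 𝓝 w, ContinuousAt T v) (hF : ∀ᶠ v in 𝓝 w, DifferentiableAt ℂ F v)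
    (h : ∀ᶠ v in 𝓝 w, T v ^ m = F v) : DifferentiableAt ℂ T w := by
  by_cases h0 : T w = 0
  · have hFa := Complex.analyticAt_iff_eventually_differentiableAt.2 hF
    rcases hFa.eventually_eq_zero_or_eventually_ne_zero with h1 | h1
    · have : T =ᶠ[𝓝 w] fun _ => 0 := by
        filter_upwards [h, h1] with v hv hv'
        rw [hv'] at hv
        exact pow_eq_zero_iff hm |>.1 hv
      exact (differentiableAt_const _).congr_of_eventuallyEq this
    · refine (Complex.analyticAt_of_differentiable_on_punctured_nhds_of_continuousAt ?_
        hT.self_of_nhds).differentiableAt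
      filter_upwards [h1, hT.filter_mono nhdsWithin_le_nhds, hF.filter_mono nhdsWithin_le_nhds,
        h.eventually_nhds.filter_mono nhdsWithin_le_nhds] with v hv hTv hFv hv'
      refine differentiableAt_of_pow_of_ne_zero hm hTv hFv hv' fun h2 => hv ?_
      rw [← hv'.self_of_nhds, h2, zero_pow hm]
  · exact differentiableAt_of_pow_of_ne_zero hm hT.self_of_nhds hF.self_of_nhds h h0

/-- Near a zero, a holomorphic function that does not vanish identically is a power of a local
coordinate. -/
theorem exists_eq_pow_coordinate {F : ℂ → ℂ} {w₀ : ℂ} (hF : AnalyticAt ℂ F w₀) (h0 : F w₀ = 0)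
    (hne : ¬ ∀ᶠ w in 𝓝 w₀, F w = 0) :
    ∃ (n : ℕ) (e : OpenPartialHomeomorph ℂ ℂ), n ≠ 0 ∧ w₀ ∈ e.source ∧ e w₀ = 0 ∧
      ∀ᶠ w in 𝓝 w₀, F w = e w ^ n := by
  obtain ⟨n, g, hg, hg0, hFg⟩ := hF.exists_eventuallyEq_pow_smul_nonzero_iff.2 hne
  have hn : n ≠ 0 := by
    rintro rfl
    have := hFg.self_of_nhds
    simp [h0] at this
    exact hg0 this.symm
  obtain ⟨c, hc⟩ := IsAlgClosed.exists_pow_nat_eq (g w₀) (Nat.pos_of_ne_zero hn)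
  have hc0 : c ≠ 0 := by
    rintro rfl
    rw [zero_pow hn] at hc
    exact hg0 hc.symm
  -- an `n`-th root of `g` near `w₀`; dividing by `g w₀` keeps the logarithm near `log 1`
  set r : ℂ → ℂ := fun w => c * Complex.exp (Complex.log (g w / g w₀) / n) with hr
  have hra : AnalyticAt ℂ r w₀ := by
    refine analyticAt_const.mul (AnalyticAt.cexp ?_)
    refine AnalyticAt.div (AnalyticAt.clog (hg.div analyticAt_const hg0) ?_) analyticAt_const
      (Nat.cast_ne_zero.2 hn)
    simp [div_self hg0]
  have hr0 : r w₀ = c := by simp [hr, div_self hg0]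
  have hrn : ∀ᶠ w in 𝓝 w₀, r w ^ n = g w := by
    filter_upwards [hg.continuousAt.eventually_ne hg0] with w hw
    rw [hr]
    simp only
    rw [mul_pow, hc, ← Complex.exp_nat_mul, mul_div_cancel₀ _ (Nat.cast_ne_zero.2 hn),
      Complex.exp_log (div_ne_zero hw hg0), mul_div_cancel₀ _ hg0]
  have hd : HasStrictDerivAt (fun w => (w - w₀) * r w) c w₀ := by
    have h1 : HasStrictDerivAt (fun w : ℂ => w - w₀) 1 w₀ :=
      (hasStrictDerivAt_id w₀).sub_const w₀
    have := h1.fun_mul hra.hasStrictDerivAt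
    simpa [hr0] using this
  have he := hd.hasStrictFDerivAt_equiv hc0
  refine ⟨n, he.toOpenPartialHomeomorph _, hn, he.mem_toOpenPartialHomeomorph_source, ?_, ?_⟩
  · simp
  · filter_upwards [hFg, hrn] with w h1 h2
    rw [h1, HasStrictFDerivAt.toOpenPartialHomeomorph_coe, mul_pow, h2, smul_eq_mul]

/-! ### Locally injective maps -/

/-- `f` is injective on some neighbourhood of `x`. For a nonconstant holomorphic map this says that
`f` is unramified at `x`. -/
def IsLocallyInjectiveAt {X Y : Type*} [TopologicalSpace X] (f : X → Y) (x : X) : Prop :=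
  ∃ U ∈ 𝓝 x, InjOn f U

theorem IsLocallyInjectiveAt.of_comp_right {X Y Z : Type*} [TopologicalSpace X]
    [TopologicalSpace Y] {a : Y → Z} {b : X → Y} {x : X}
    (h : IsLocallyInjectiveAt (a ∘ b) x) : IsLocallyInjectiveAt b x := by
  obtain ⟨U, hU, hinj⟩ := h
  exact ⟨U, hU, fun x hx y hy hxy => hinj hx hy (congrArg a hxy)⟩

theorem IsLocallyInjectiveAt.of_comp_left {X Y Z : Type*} [TopologicalSpace X]
    [TopologicalSpace Y] {a : Y → Z} {b : X → Y} {x : X} (hb : IsOpenMap b)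
    (h : IsLocallyInjectiveAt (a ∘ b) x) : IsLocallyInjectiveAt a (b x) := by
  obtain ⟨U, hU, hinj⟩ := h
  refine ⟨b '' U, hb.image_mem_nhds hU, ?_⟩
  rintro _ ⟨u, hu, rfl⟩ _ ⟨u', hu', rfl⟩ h
  rw [hinj hu hu' h]

/-- Uniqueness of lifts: two lifts of the same map through `a` that agree at one point of a
connected space agree everywhere, provided `a` is locally injective at the points met. -/
theorem eq_of_comp_eq_of_isLocallyInjectiveAt {W R Z : Type*} [TopologicalSpace W]
    [PreconnectedSpace W] [TopologicalSpace R] [T2Space R] {a : R → Z} {h₁ h₂ : W → R}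
    (hc₁ : Continuous h₁) (hc₂ : Continuous h₂) (hcomp : ∀ w, a (h₁ w) = a (h₂ w))
    (hinj : ∀ w, IsLocallyInjectiveAt a (h₁ w)) {w₀ : W} (h0 : h₁ w₀ = h₂ w₀) (w : W) :
    h₁ w = h₂ w := by
  have hcl : IsClosed {w | h₁ w = h₂ w} := isClosed_eq hc₁ hc₂
  have hop : IsOpen {w | h₁ w = h₂ w} := by
    rw [isOpen_iff_mem_nhds]
    intro w hw
    obtain ⟨U, hU, hi⟩ := hinj w
    filter_upwards [hc₁.continuousAt hU, hc₂.continuousAt (show U ∈ 𝓝 (h₂ w) from hw ▸ hU)]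
      with v hv hv'
    exact hi hv hv' (hcomp v)
  have huniv := IsClopen.eq_univ ⟨hcl, hop⟩ ⟨w₀, h0⟩
  exact eq_univ_iff_forall.1 huniv w

theorem isLocallyInjectiveAt_pow {n : ℕ} (hn : n ≠ 0) {u : ℂ} (hu : u ≠ 0) :
    IsLocallyInjectiveAt (fun z : ℂ => z ^ n) u := by
  have hs : HasStrictDerivAt (fun z : ℂ => z ^ n) (n * u ^ (n - 1)) u := hasStrictDerivAt_pow n u
  have hne : (n * u ^ (n - 1) : ℂ) ≠ 0 :=
    mul_ne_zero (Nat.cast_ne_zero.2 hn) (pow_ne_zero _ hu)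
  exact ⟨_, (hs.hasStrictFDerivAt_equiv hne).eventually_left_inverse,
    Set.LeftInvOn.injOn fun _ h => h⟩

/-- In a compact space a set that meets a neighbourhood of each point `x` at most in `x` is
finite. -/
theorem finite_of_forall_nhds_inter_subset {X : Type*} [TopologicalSpace X] [CompactSpace X]
    {A : Set X} (h : ∀ x, ∃ U ∈ 𝓝 x, U ∩ A ⊆ {x}) : A.Finite := by
  choose U hU hUA using h
  obtain ⟨t, ht⟩ := CompactSpace.elim_nhds_subcover U hU
  refine t.finite_toSet.subset fun a ha => ?_
  obtain ⟨x, hx, hax⟩ := mem_iUnion₂.1 (ht.symm ▸ mem_univ a : a ∈ ⋃ x ∈ t, U x)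
  rw [mem_singleton_iff.1 (hUA x ⟨hax, ha⟩)]
  exact hx

/-! ### Punctured surfaces are connected -/

theorem exp_image_re_lt {r : ℝ} (hr : 0 < r) :
    Complex.exp '' {w | w.re < Real.log r} = Metric.ball 0 r \ {0} := by
  ext z
  constructor
  · rintro ⟨w, hw, rfl⟩
    refine ⟨?_, Complex.exp_ne_zero w⟩
    rw [mem_ball_zero_iff, Complex.norm_exp]
    exact (Real.lt_log_iff_exp_lt hr).1 hw
  · rintro ⟨hz, hz0⟩
    refine ⟨Complex.log z, ?_, Complex.exp_log hz0⟩
    rw [mem_ball_zero_iff] at hz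
    rw [mem_ofPred_eq, Complex.log_re]
    exact Real.log_lt_log (norm_pos_iff.2 hz0) hz

theorem isPreconnected_ball_diff_zero (r : ℝ) :
    IsPreconnected (Metric.ball (0 : ℂ) r \ {0}) := by
  rcases le_or_gt r 0 with hr | hr
  · simp [Metric.ball_eq_empty.2 hr, isPreconnected_empty]
  · rw [← exp_image_re_lt hr]
    exact (convex_halfSpace_re_lt _).isPreconnected.image _ Complex.continuous_exp.continuousOn

theorem isPreconnected_ball_diff_singleton (c : ℂ) (r : ℝ) :
    IsPreconnected (Metric.ball c r \ {c}) := by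
  have := (isPreconnected_ball_diff_zero r).image (fun z => z + c) (by fun_prop)
  convert this using 1
  ext z
  simp only [Set.mem_sdiff, Metric.mem_ball, mem_singleton_iff, mem_image, dist_zero_right]
  constructor
  · rintro ⟨h, h'⟩
    exact ⟨z - c, ⟨by rwa [← dist_eq_norm], sub_ne_zero.2 h'⟩, by ring⟩
  · rintro ⟨w, ⟨h, h'⟩, rfl⟩
    exact ⟨by simpa using h, by simpa using h'⟩

section Charted

variable {X : Type u} [TopologicalSpace X] [ChartedSpace ℂ X]
  {Y : Type v} [TopologicalSpace Y] [ChartedSpace ℂ Y]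

theorem exists_nhds_diff_isPreconnected (x : X) {W : Set X} (hW : W ∈ 𝓝 x) :
    ∃ V ⊆ W, V ∈ 𝓝 x ∧ IsPreconnected (V \ {x}) ∧ (V \ {x}).Nonempty := by
  set c := chartAt ℂ x
  have hxs : x ∈ c.source := mem_chart_source ℂ x
  have hN : c.target ∩ c.symm ⁻¹' W ∈ 𝓝 (c x) :=
    inter_mem (c.open_target.mem_nhds (c.map_source hxs))
      ((c.continuousAt_symm (c.map_source hxs)) (by rwa [c.left_inv hxs]))
  obtain ⟨r, hr, hsub⟩ := Metric.mem_nhds_iff.1 hN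
  have himg : c.symm '' Metric.ball (c x) r \ {x} = c.symm '' (Metric.ball (c x) r \ {c x}) := by
    ext y
    constructor
    · rintro ⟨⟨w, hw, rfl⟩, hy⟩
      refine ⟨w, ⟨hw, ?_⟩, rfl⟩
      rintro rfl
      exact hy (c.left_inv hxs)
    · rintro ⟨w, ⟨hw, hw'⟩, rfl⟩
      refine ⟨⟨w, hw, rfl⟩, fun h => hw' ?_⟩
      rw [mem_singleton_iff, ← c.right_inv (hsub hw).1, mem_singleton_iff.1 h]
  refine ⟨c.symm '' Metric.ball (c x) r, ?_, ?_, ?_, ?_⟩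
  · rintro _ ⟨w, hw, rfl⟩
    exact (hsub hw).2
  · have := c.symm.image_mem_nhds (x := c x) (c.map_source hxs) (Metric.ball_mem_nhds _ hr)
    rwa [c.left_inv hxs] at this
  · rw [himg]
    exact (isPreconnected_ball_diff_singleton _ _).image _
      (c.continuousOn_symm.mono fun w hw => (hsub hw.1).1)
  · rw [himg]
    refine Nonempty.image _ ⟨c x + (r / 2 : ℝ), ?_, ?_⟩
    · rw [Metric.mem_ball, dist_eq_norm, add_sub_cancel_left, Complex.norm_real, Real.norm_eq_abs,
        abs_of_pos (half_pos hr)]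
      exact half_lt_self hr
    · rw [mem_singleton_iff, add_eq_left]
      exact_mod_cast (half_pos hr).ne'

theorem exists_mem_notMem_of_finite [T1Space X] {B : Set X} (hB : B.Finite) {W : Set X}
    (hW : IsOpen W) (hne : W.Nonempty) : ∃ x ∈ W, x ∉ B := by
  obtain ⟨x, hx⟩ := hne
  have hWB : W ∩ (B \ {x})ᶜ ∈ 𝓝 x :=
    inter_mem (hW.mem_nhds hx) ((hB.subset sdiff_subset).isClosed.isOpen_compl.mem_nhds (by simp))
  obtain ⟨V, hVW, -, -, y, hy, hyx⟩ := exists_nhds_diff_isPreconnected x hWB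
  exact ⟨y, (hVW hy).1, fun h => (hVW hy).2 ⟨h, hyx⟩⟩

/-- A connected surface stays connected when finitely many points are removed. -/
theorem isPreconnected_compl_of_finite [T1Space X] [PreconnectedSpace X] {B : Set X}
    (hB : B.Finite) : IsPreconnected Bᶜ := by
  refine isPreconnected_of_forall_constant fun χ hχ => ?_
  -- a small punctured neighbourhood of each point is connected, so `χ` is constant on it
  have key : ∀ x, ∃ V ∈ 𝓝 x, V \ {x} ⊆ Bᶜ ∧
      ∃ v, (∀ y ∈ V \ {x}, χ y = v) ∧ (x ∉ B → χ x = v) := by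
    intro x
    have hx : (B \ {x})ᶜ ∈ 𝓝 x :=
      (hB.subset sdiff_subset).isClosed.isOpen_compl.mem_nhds (by simp)
    by_cases hxB : x ∈ B
    · obtain ⟨V, hVW, hV, hVc, z, hz⟩ := exists_nhds_diff_isPreconnected x hx
      have hsub : V \ {x} ⊆ Bᶜ := fun y hy hyB => hVW hy.1 ⟨hyB, hy.2⟩
      exact ⟨V, hV, hsub, χ z, fun y hy => hVc.constant (hχ.mono hsub) hy hz,
        fun h => absurd hxB h⟩
    · have hBx : Bᶜ ∈ 𝓝 x := hB.isClosed.isOpen_compl.mem_nhds hxB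
      have hc : ContinuousAt χ x := hχ.continuousAt hBx
      refine ⟨{y | χ y = χ x} ∩ Bᶜ, inter_mem (hc.preimage_mem_nhds (t := {χ x}) (by simp)) hBx,
        fun y hy => hy.1.2, χ x,
        fun y hy => hy.1.1, fun _ => rfl⟩
  choose V hV hVB v hv hvx using key
  -- `v` extends `χ` to a locally constant function on the whole surface
  have hloc : IsLocallyConstant v := by
    rw [IsLocallyConstant.iff_eventually_eq]
    intro x
    filter_upwards [hV x] with y hy
    by_cases hyx : y = x
    · rw [hyx]
    · rw [← hvx y (hVB x ⟨hy, hyx⟩), hv x y ⟨hy, hyx⟩]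
  intro x hx y hy
  rw [hvx x hx, hvx y hy]
  exact hloc.apply_eq_of_preconnectedSpace x y

end Charted

/-! ### Local structure of nonconstant holomorphic maps -/

section PowerChart

variable {X : Type u} [TopologicalSpace X] {Y : Type v} [TopologicalSpace Y] [ChartedSpace ℂ Y]

/-- A local coordinate `t` of `X` centred at `x`, with values in a disc, in which `f` is the power
map `t ↦ t ^ n` with respect to the preferred chart of `Y` at `f x`. The coordinate need only be a
homeomorphism: its holomorphy is never used. -/
structure PowerChart (f : X → Y) (x : X) where
  /-- the coordinate -/
  coord : OpenPartialHomeomorph X ℂ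
  /-- the radius of the disc of values -/
  radius : ℝ
  /-- the exponent, that is, the ramification index of `f` at `x` -/
  exponent : ℕ
  mem_source : x ∈ coord.source
  coord_center : coord x = 0
  radius_pos : 0 < radius
  target_eq : coord.target = Metric.ball 0 radius
  exponent_ne_zero : exponent ≠ 0
  mem_chart : ∀ y ∈ coord.source, f y ∈ (chartAt ℂ (f x)).source
  pow_eq : ∀ y ∈ coord.source,
    coord y ^ exponent = chartAt ℂ (f x) (f y) - chartAt ℂ (f x) (f x)

namespace PowerChart

variable {f : X → Y} {x : X}

theorem mem_target_iff (P : PowerChart f x) {w : ℂ} : w ∈ P.coord.target ↔ ‖w‖ < P.radius := by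
  rw [P.target_eq, mem_ball_zero_iff]

theorem norm_coord_lt (P : PowerChart f x) {y : X} (hy : y ∈ P.coord.source) :
    ‖P.coord y‖ < P.radius :=
  P.mem_target_iff.1 (P.coord.map_source hy)

theorem coord_eq_zero_iff (P : PowerChart f x) {y : X} (hy : y ∈ P.coord.source) :
    P.coord y = 0 ↔ y = x := by
  rw [← P.coord_center]
  exact P.coord.injOn.eq_iff hy P.mem_source

theorem source_mem_nhds (P : PowerChart f x) : P.coord.source ∈ 𝓝 x :=
  P.coord.open_source.mem_nhds P.mem_source

theorem apply_eq_iff (P : PowerChart f x) {y y' : X} (hy : y ∈ P.coord.source)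
    (hy' : y' ∈ P.coord.source) :
    f y = f y' ↔ P.coord y ^ P.exponent = P.coord y' ^ P.exponent := by
  rw [P.pow_eq y hy, P.pow_eq y' hy', sub_left_inj]
  exact ((chartAt ℂ (f x)).injOn.eq_iff (P.mem_chart y hy) (P.mem_chart y' hy')).symm

theorem eq_center (P : PowerChart f x) {y : X} (hy : y ∈ P.coord.source) (h : f y = f x) :
    y = x := by
  rw [P.apply_eq_iff hy P.mem_source, P.coord_center, zero_pow P.exponent_ne_zero] at h
  exact (P.coord_eq_zero_iff hy).1 ((pow_eq_zero_iff P.exponent_ne_zero).1 h)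

theorem image_source_mem_nhds (P : PowerChart f x) : f '' P.coord.source ∈ 𝓝 (f x) := by
  set d := chartAt ℂ (f x)
  have hfx : f x ∈ d.source := mem_chart_source ℂ (f x)
  have h1 : ∀ᶠ y in 𝓝 (f x), dist (d y) (d (f x)) < P.radius ^ P.exponent :=
    (d.continuousAt hfx).eventually (Metric.ball_mem_nhds _ (pow_pos P.radius_pos _))
  filter_upwards [h1, d.open_source.mem_nhds hfx] with y hy hyd
  obtain ⟨w, hw⟩ := IsAlgClosed.exists_pow_nat_eq (d y - d (f x))
    (Nat.pos_of_ne_zero P.exponent_ne_zero)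
  have hwt : w ∈ P.coord.target := by
    rw [P.mem_target_iff]
    rw [dist_eq_norm, ← hw, norm_pow] at hy
    exact lt_of_pow_lt_pow_left₀ _ P.radius_pos.le hy
  have hs := P.coord.map_target hwt
  refine ⟨_, hs, d.injOn (P.mem_chart _ hs) hyd ?_⟩
  have := P.pow_eq _ hs
  rw [P.coord.right_inv hwt, hw, sub_left_inj] at this
  exact this.symm

theorem isLocallyInjectiveAt (P : PowerChart f x) {y : X} (hy : y ∈ P.coord.source) (hyx : y ≠ x) :
    IsLocallyInjectiveAt f y := by
  obtain ⟨U, hU, hinj⟩ := isLocallyInjectiveAt_pow P.exponent_ne_zero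
    (mt (P.coord_eq_zero_iff hy).1 hyx)
  refine ⟨P.coord.source ∩ P.coord ⁻¹' U, inter_mem (P.coord.open_source.mem_nhds hy)
    (P.coord.continuousAt hy hU), ?_⟩
  rintro a ⟨ha, haU⟩ b ⟨hb, hbU⟩ hab
  exact P.coord.injOn ha hb (hinj haU hbU ((P.apply_eq_iff ha hb).1 hab))

end PowerChart

end PowerChart

section Local

variable {X : Type u} [TopologicalSpace X] [ChartedSpace ℂ X]
  {Y : Type v} [TopologicalSpace Y] [ChartedSpace ℂ Y]

theorem differentiableAt_coordinate [IsManifold 𝓘(ℂ) ω X] [IsManifold 𝓘(ℂ) ω Y] {f : X → Y}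
    (hf : MDifferentiable 𝓘(ℂ) 𝓘(ℂ) f) (x : X) (y : Y) {w : ℂ} (hw : w ∈ (chartAt ℂ x).target)
    (hw' : f ((chartAt ℂ x).symm w) ∈ (chartAt ℂ y).source) :
    DifferentiableAt ℂ (fun w => chartAt ℂ y (f ((chartAt ℂ x).symm w))) w := by
  rw [← mdifferentiableAt_iff_differentiableAt]
  have h1 := mdifferentiableAt_atlas_symm (I := 𝓘(ℂ)) (chart_mem_atlas ℂ x) hw
  have h2 := mdifferentiableAt_atlas (I := 𝓘(ℂ)) (chart_mem_atlas ℂ y) hw'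
  exact h2.comp w ((hf _).comp w h1)

theorem IsNonconstantHolomorphic.continuous {f : X → Y} (hf : IsNonconstantHolomorphic f) :
    Continuous f :=
  hf.mdifferentiable.continuous

/-- Identity theorem: a nonconstant holomorphic map is not constant near any point. -/
theorem IsNonconstantHolomorphic.not_eventually_eq [IsManifold 𝓘(ℂ) ω X] [IsManifold 𝓘(ℂ) ω Y]
    [PreconnectedSpace X] {f : X → Y} (hf : IsNonconstantHolomorphic f) (x : X) :
    ¬ ∀ᶠ y in 𝓝 x, f y = f x := by
  intro hx
  set A : Set X := {x | ∀ᶠ y in 𝓝 x, f y = f x} with hA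
  have hop : IsOpen A := by
    rw [isOpen_iff_mem_nhds]
    intro x hx
    filter_upwards [eventually_eventually_nhds.2 hx, hx] with y hy hy'
    rw [hA, mem_ofPred_eq, hy']
    exact hy
  have hcl : IsClosed A := by
    refine isClosed_of_closure_subset fun x hx => ?_
    set c := chartAt ℂ x
    set d := chartAt ℂ (f x)
    have hxs : x ∈ c.source := mem_chart_source ℂ x
    have hct : ContinuousAt c.symm (c x) := c.continuousAt_symm (c.map_source hxs)
    have hN : c.target ∩ {w | f (c.symm w) ∈ d.source} ∈ 𝓝 (c x) := by
      refine inter_mem (c.open_target.mem_nhds (c.map_source hxs)) ?_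
      refine (hf.continuous.continuousAt.comp hct) (d.open_source.mem_nhds ?_)
      rw [Function.comp_apply, c.left_inv hxs]
      exact mem_chart_source ℂ (f x)
    obtain ⟨r, hr, hsub⟩ := Metric.mem_nhds_iff.1 hN
    set F : ℂ → ℂ := fun w => d (f (c.symm w))
    have hFa : AnalyticOnNhd ℂ F (Metric.ball (c x) r) := by
      refine DifferentiableOn.analyticOnNhd (fun w hw => ?_) Metric.isOpen_ball
      exact (differentiableAt_coordinate hf.mdifferentiable x (f x) (hsub hw).1
        (hsub hw).2).differentiableWithinAt
    have hcN : c.source ∩ c ⁻¹' Metric.ball (c x) r ∈ 𝓝 x :=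
      inter_mem (c.open_source.mem_nhds hxs)
        ((c.continuousAt hxs).preimage_mem_nhds (Metric.ball_mem_nhds _ hr))
    obtain ⟨x', ⟨hx's, hx'b⟩, hx'A⟩ := mem_closure_iff_nhds.1 hx _ hcN
    have hev : F =ᶠ[𝓝 (c x')] fun _ => d (f x') := by
      have h1 : Tendsto c.symm (𝓝 (c x')) (𝓝 x') := by
        have := c.continuousAt_symm (c.map_source hx's)
        rwa [ContinuousAt, c.left_inv hx's] at this
      filter_upwards [h1.eventually hx'A] with w hw
      exact congrArg d hw
    have heq : EqOn F (fun _ => d (f x')) (Metric.ball (c x) r) :=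
      hFa.eqOn_of_preconnected_of_eventuallyEq (fun _ _ => analyticAt_const)
        (convex_ball _ _).isPreconnected hx'b hev
    have hval : ∀ y ∈ c.source ∩ c ⁻¹' Metric.ball (c x) r, f y = f x' := by
      rintro y ⟨hys, hyb⟩
      have h1 : d (f y) = d (f x') := by
        have := heq hyb
        simpa only [F, c.left_inv hys] using this
      refine d.injOn ?_ ?_ h1
      · simpa only [mem_ofPred_eq, c.left_inv hys] using (hsub hyb).2
      · simpa only [mem_ofPred_eq, c.left_inv hx's] using (hsub hx'b).2
    filter_upwards [hcN] with y hy
    rw [hval y hy, hval x (mem_of_mem_nhds hcN)]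
  have huniv : A = univ := IsClopen.eq_univ ⟨hcl, hop⟩ ⟨x, hx⟩
  have hlc : IsLocallyConstant f :=
    (IsLocallyConstant.iff_eventually_eq f).2 fun y => eq_univ_iff_forall.1 huniv y
  exact hf.nonconstant ⟨f x, fun y => hlc.apply_eq_of_preconnectedSpace y x⟩

theorem IsNonconstantHolomorphic.exists_powerChart [IsManifold 𝓘(ℂ) ω X] [IsManifold 𝓘(ℂ) ω Y]
    [PreconnectedSpace X] {f : X → Y} (hf : IsNonconstantHolomorphic f) (x : X) {W : Set X}
    (hW : W ∈ 𝓝 x) : ∃ P : PowerChart f x, P.coord.source ⊆ W := by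
  set c := chartAt ℂ x
  set d := chartAt ℂ (f x)
  have hxs : x ∈ c.source := mem_chart_source ℂ x
  have hfx : f x ∈ d.source := mem_chart_source ℂ (f x)
  have hct : ContinuousAt c.symm (c x) := c.continuousAt_symm (c.map_source hxs)
  have hct' : Tendsto c.symm (𝓝 (c x)) (𝓝 x) := by rwa [ContinuousAt, c.left_inv hxs] at hct
  have hd : ∀ᶠ y in 𝓝 x, f y ∈ d.source :=
    hf.continuous.continuousAt (d.open_source.mem_nhds hfx)
  set F : ℂ → ℂ := fun w => d (f (c.symm w)) - d (f x)
  have hFa : AnalyticAt ℂ F (c x) := by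
    rw [Complex.analyticAt_iff_eventually_differentiableAt]
    filter_upwards [c.open_target.mem_nhds (c.map_source hxs), hct'.eventually hd] with w h1 h2
    exact (differentiableAt_coordinate hf.mdifferentiable x (f x) h1 h2).sub_const _
  have hF0 : F (c x) = 0 := by simp [F, c.left_inv hxs]
  have hFne : ¬ ∀ᶠ w in 𝓝 (c x), F w = 0 := by
    intro h
    refine hf.not_eventually_eq x ?_
    filter_upwards [(c.continuousAt hxs).eventually h, hd, c.open_source.mem_nhds hxs]
      with y h1 h2 h3
    refine d.injOn h2 hfx ?_
    simpa only [F, c.left_inv h3, sub_eq_zero] using h1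
  obtain ⟨n, e, hn, hes, he0, hev⟩ := exists_eq_pow_coordinate hFa hF0 hFne
  have hgood : ∀ᶠ y in 𝓝 x, y ∈ W ∧ f y ∈ d.source ∧ F (c y) = e (c y) ^ n := by
    filter_upwards [hW, hd, (c.continuousAt hxs).eventually hev] with y h1 h2 h3
    exact ⟨h1, h2, h3⟩
  obtain ⟨V, hV, hVo, hxV⟩ := eventually_nhds_iff.1 hgood
  set s := (c.trans e).restr V with hs
  have hss : s.source = (c.source ∩ c ⁻¹' e.source) ∩ V := by
    rw [hs, OpenPartialHomeomorph.restr_source, hVo.interior_eq,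
      OpenPartialHomeomorph.trans_source]
  have hs_apply : ∀ y, s y = e (c y) := fun y => rfl
  have hxss : x ∈ s.source := hss ▸ ⟨⟨hxs, hes⟩, hxV⟩
  have hs0 : s x = 0 := he0
  have h0t : (0 : ℂ) ∈ s.target := hs0 ▸ s.map_source hxss
  obtain ⟨r, hr, hrt⟩ := Metric.mem_nhds_iff.1 (s.open_target.mem_nhds h0t)
  set t := (s.symm.restrOpen (Metric.ball 0 r) Metric.isOpen_ball).symm with ht
  have ht_target : t.target = Metric.ball 0 r := by
    rw [ht, OpenPartialHomeomorph.symm_target, OpenPartialHomeomorph.restrOpen_source,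
      OpenPartialHomeomorph.symm_source]
    exact inter_eq_right.2 hrt
  have ht_apply : ∀ y, t y = s y := fun y => rfl
  have ht_source : t.source ⊆ s.source := fun y hy => hy.1
  have hxt : x ∈ t.source := by
    refine ⟨hxss, ?_⟩
    change s x ∈ Metric.ball 0 r
    rw [hs0]
    exact Metric.mem_ball_self hr
  have hVt : ∀ y ∈ t.source, y ∈ c.source ∧ y ∈ V := fun y hy => by
    have := ht_source hy
    rw [hss] at this
    exact ⟨this.1.1, this.2⟩
  refine ⟨⟨t, r, n, hxt, hs0, hr, ht_target, hn, fun y hy => (hV y (hVt y hy).2).2.1,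
    fun y hy => ?_⟩, fun y hy => (hV y (hVt y hy).2).1⟩
  have := (hV y (hVt y hy).2).2.2
  rw [ht_apply, hs_apply, ← this]
  simp only [F, c.left_inv (hVt y hy).1]
  rfl

theorem isLocallyInjectiveAt_of_mfderiv_ne_zero [IsManifold 𝓘(ℂ) ω X]
    [IsManifold 𝓘(ℂ) ω Y] {f : X → Y} (hf : MDifferentiable 𝓘(ℂ) 𝓘(ℂ) f)
    {x : X} (hx : mfderiv 𝓘(ℂ) 𝓘(ℂ) f x ≠ 0) : IsLocallyInjectiveAt f x := by
  set c := chartAt ℂ x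
  set d := chartAt ℂ (f x)
  have hxs : x ∈ c.source := mem_chart_source ℂ x
  have hfx : f x ∈ d.source := mem_chart_source ℂ (f x)
  have hct : ContinuousAt c.symm (c x) := c.continuousAt_symm (c.map_source hxs)
  have hct' : Tendsto c.symm (𝓝 (c x)) (𝓝 x) := by rwa [ContinuousAt, c.left_inv hxs] at hct
  have hd : ∀ᶠ y in 𝓝 x, f y ∈ d.source :=
    hf.continuous.continuousAt (d.open_source.mem_nhds hfx)
  set F : ℂ → ℂ := fun w => d (f (c.symm w))
  have hFa : AnalyticAt ℂ F (c x) := by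
    rw [Complex.analyticAt_iff_eventually_differentiableAt]
    filter_upwards [c.open_target.mem_nhds (c.map_source hxs), hct'.eventually hd] with w h1 h2
    exact differentiableAt_coordinate hf x (f x) h1 h2
  have hderiv : deriv F (c x) ≠ 0 := by
    intro h0
    have h1 : fderiv ℂ F (c x) = 0 := by
      ext
      simp [h0]
    refine hx ?_
    rw [(hf x).mfderiv]
    simp only [mfld_simps, fderivWithin_univ]
    exact h1
  have hleft := (hFa.hasStrictDerivAt.hasStrictFDerivAt_equiv hderiv).eventually_left_inverse
  refine ⟨_, inter_mem (c.open_source.mem_nhds hxs) ((c.continuousAt hxs).eventually hleft), ?_⟩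
  rintro a ⟨ha, ha'⟩ b ⟨hb, hb'⟩ hab
  have hFab : F (c a) = F (c b) := by simp only [F, c.left_inv ha, c.left_inv hb, hab]
  refine c.injOn ha hb ?_
  have ha'' := ha'
  have hb'' := hb'
  simp only [mem_ofPred_eq] at ha'' hb''
  rw [← ha'', ← hb'', hFab]

variable [IsManifold 𝓘(ℂ) ω X] [IsManifold 𝓘(ℂ) ω Y] [PreconnectedSpace X]

theorem IsNonconstantHolomorphic.isOpenMap {f : X → Y} (hf : IsNonconstantHolomorphic f) :
    IsOpenMap f := by
  rw [isOpenMap_iff_nhds_le]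
  intro x W hW
  obtain ⟨P, hP⟩ := hf.exists_powerChart x hW
  exact mem_of_superset P.image_source_mem_nhds (image_subset_iff.2 hP)

theorem IsNonconstantHolomorphic.finite_fiber [CompactSpace X] [T1Space Y] {f : X → Y}
    (hf : IsNonconstantHolomorphic f) (y : Y) : (f ⁻¹' {y}).Finite := by
  refine finite_of_forall_nhds_inter_subset fun x => ?_
  by_cases hx : f x = y
  · obtain ⟨P, -⟩ := hf.exists_powerChart x univ_mem
    exact ⟨_, P.source_mem_nhds, fun x' hx' => P.eq_center hx'.1 (hx'.2.trans hx.symm)⟩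
  · exact ⟨f ⁻¹' {y}ᶜ, hf.continuous.continuousAt (isOpen_compl_singleton.mem_nhds hx),
      fun x' hx' => absurd hx'.2 hx'.1⟩

theorem IsNonconstantHolomorphic.finite_ramification [CompactSpace X] {f : X → Y}
    (hf : IsNonconstantHolomorphic f) : {x | ¬ IsLocallyInjectiveAt f x}.Finite := by
  refine finite_of_forall_nhds_inter_subset fun x => ?_
  obtain ⟨P, -⟩ := hf.exists_powerChart x univ_mem
  exact ⟨_, P.source_mem_nhds, fun y hy => by_contra fun h => hy.2 (P.isLocallyInjectiveAt hy.1 h)⟩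

theorem IsNonconstantHolomorphic.surjective [CompactSpace X] [Nonempty X] [T2Space Y]
    [PreconnectedSpace Y] {f : X → Y} (hf : IsNonconstantHolomorphic f) :
    Function.Surjective f := by
  rw [← range_eq_univ]
  exact IsClopen.eq_univ ⟨(isCompact_range hf.continuous).isClosed, hf.isOpenMap.isOpen_range⟩
    (range_nonempty f)

theorem IsNonconstantHolomorphic.degree_eq_one_iff [CompactSpace X] [T1Space Y] [Nonempty X]
    {f : X → Y} (hf : IsNonconstantHolomorphic f) : degree f = 1 ↔ Function.Injective f := by
  constructor
  · intro h x x' hxx'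
    -- an unbounded supremum in `ℕ` is `0`, so degree one includes boundedness
    have hbdd : BddAbove (range fun y => (f ⁻¹' {y}).ncard) := by
      by_contra hb
      rw [degree, iSup, Nat.sSup_of_not_bddAbove hb] at h
      exact zero_ne_one h
    have hle : (f ⁻¹' {f x}).ncard ≤ 1 := h ▸ le_ciSup hbdd (f x)
    exact (ncard_le_one (hf.finite_fiber _)).1 hle x rfl x' hxx'.symm
  · intro hinj
    have hle : ∀ y, (f ⁻¹' {y}).ncard ≤ 1 := fun y =>
      (ncard_le_one (hf.finite_fiber y)).2 fun a ha b hb => hinj (ha.trans hb.symm)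
    obtain ⟨x⟩ := ‹Nonempty X›
    have : Nonempty Y := ⟨f x⟩
    refine le_antisymm (ciSup_le hle) ?_
    refine le_trans ?_ (le_ciSup (f := fun y => (f ⁻¹' {y}).ncard)
      ⟨1, forall_mem_range.2 hle⟩ (f x))
    exact (ncard_pos (hf.finite_fiber _)).2 ⟨x, rfl⟩

/-- A holomorphic map with a fibre that consists of one unramified point is injective: over the
connected complement of the critical values the number of preimages is locally constant. -/
theorem IsNonconstantHolomorphic.injective_of_subsingleton_fiber [CompactSpace X] [T2Space X]
    [T2Space Y] [PreconnectedSpace Y] {f : X → Y} (hf : IsNonconstantHolomorphic f) {x₀ : X}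
    (hx₀ : IsLocallyInjectiveAt f x₀) (hfib : ∀ x, f x = f x₀ → x = x₀) :
    Function.Injective f := by
  set B : Set Y := f '' {x | ¬ IsLocallyInjectiveAt f x}
  have hB : B.Finite := hf.finite_ramification.image f
  -- the values taken at most once
  set A : Set Y := {y | (f ⁻¹' {y}).Subsingleton}
  have hopen_compl : IsOpen Aᶜ := by
    rw [isOpen_iff_mem_nhds]
    intro y hy
    obtain ⟨x₁, hx₁, x₂, hx₂, hne⟩ := not_subsingleton_iff.1 hy
    obtain ⟨U, V, hU, hV, hxU, hxV, hUV⟩ := t2_separation hne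
    have h1 : f '' U ∈ 𝓝 y :=
      (mem_singleton_iff.1 hx₁) ▸ hf.isOpenMap.image_mem_nhds (hU.mem_nhds hxU)
    have h2 : f '' V ∈ 𝓝 y :=
      (mem_singleton_iff.1 hx₂) ▸ hf.isOpenMap.image_mem_nhds (hV.mem_nhds hxV)
    filter_upwards [h1, h2]
    rintro _ ⟨u, hu, rfl⟩ ⟨v, hv, hvu⟩ hsub
    exact disjoint_left.1 hUV hu ((hsub (mem_preimage.2 rfl) (mem_preimage.2 hvu) : u = v) ▸ hv)
  have hopen : IsOpen (A \ B) := by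
    rw [isOpen_iff_mem_nhds]
    rintro y ⟨hyA, hyB⟩
    by_cases hne : ∃ x, f x = y
    · obtain ⟨x, rfl⟩ := hne
      have hx : IsLocallyInjectiveAt f x := by_contra fun h => hyB ⟨x, h, rfl⟩
      obtain ⟨U, hU, hinj⟩ := hx
      obtain ⟨V, hVU, hV, hxV⟩ := mem_nhds_iff.1 hU
      -- points near `f x` have all their preimages in `V`, where `f` is injective
      have hcl : IsClosed (f '' Vᶜ) := (hV.isClosed_compl.isCompact.image hf.continuous).isClosed
      have hy : f x ∉ f '' Vᶜ := by
        rintro ⟨x', hx', h⟩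
        exact hx' (hyA h rfl ▸ hxV)
      filter_upwards [hcl.isOpen_compl.mem_nhds hy, hB.isClosed.isOpen_compl.mem_nhds hyB]
        with z hz hzB
      refine ⟨fun a ha b hb => ?_, hzB⟩
      have hmem : ∀ a, f a = z → a ∈ V := fun a ha => by_contra fun h => hz ⟨a, h, ha⟩
      exact hinj (hVU (hmem a ha)) (hVU (hmem b hb)) ((mem_singleton_iff.1 ha).trans hb.symm)
    · have hyr : y ∈ (range f)ᶜ := fun ⟨x, hx⟩ => hne ⟨x, hx⟩
      filter_upwards [(isCompact_range hf.continuous).isClosed.isOpen_compl.mem_nhds hyr] with z hz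
      exact ⟨fun a ha => absurd ⟨a, ha⟩ hz, fun ⟨a, _, ha⟩ => hz ⟨a, ha⟩⟩
  have hy₀A : f x₀ ∈ A := fun a ha b hb => (hfib a ha).trans (hfib b hb).symm
  have hy₀B : f x₀ ∉ B := by
    rintro ⟨x, hx, hxx⟩
    exact hx (hfib x hxx ▸ hx₀)
  have hsub : Bᶜ ⊆ A \ B :=
    (isPreconnected_compl_of_finite hB).subset_of_closure_inter_subset hopen
      ⟨f x₀, hy₀B, hy₀A, hy₀B⟩ fun y hy => ⟨by_contra fun h => by
        have h1 := mem_closure_iff.1 hy.1 _ hopen_compl h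
        obtain ⟨z, hz, hz'⟩ := h1
        exact hz hz'.1, hy.2⟩
  intro x₁ x₂ h12
  by_contra hne
  -- the set of values taken twice is open, so it would contain a value outside the finite set `B`
  obtain ⟨y, hy, hyB⟩ := exists_mem_notMem_of_finite hB hopen_compl
    ⟨f x₁, fun h => hne (h rfl h12.symm)⟩
  exact hy (hsub hyB).1

end Local

/-! ### Complex structures defined by roots -/

section RootCharts

theorem mdifferentiableAt_of_pow {X : Type*} [TopologicalSpace X] [ChartedSpace ℂ X]
    [IsManifold 𝓘(ℂ) ω X] {T G : X → ℂ} {x : X} {m : ℕ} (hm : m ≠ 0)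
    (hT : ∀ᶠ y in 𝓝 x, ContinuousAt T y)
    (hG : ∀ᶠ y in 𝓝 x, MDifferentiableAt 𝓘(ℂ) 𝓘(ℂ) G y)
    (h : ∀ᶠ y in 𝓝 x, T y ^ m = G y) : MDifferentiableAt 𝓘(ℂ) 𝓘(ℂ) T x := by
  set c := chartAt ℂ x
  have hxs : x ∈ c.source := mem_chart_source ℂ x
  have hct : Tendsto c.symm (𝓝 (c x)) (𝓝 x) := by
    have := c.continuousAt_symm (c.map_source hxs)
    rwa [ContinuousAt, c.left_inv hxs] at this
  have htar := c.open_target.mem_nhds (c.map_source hxs)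
  have hd : DifferentiableAt ℂ (T ∘ c.symm) (c x) := by
    refine differentiableAt_of_pow (F := G ∘ c.symm) hm ?_ ?_ (hct.eventually h)
    · filter_upwards [hct.eventually hT, htar] with w h1 h2
      exact ContinuousAt.comp h1 (c.continuousAt_symm h2)
    · filter_upwards [hct.eventually hG, htar] with w h1 h2
      rw [← mdifferentiableAt_iff_differentiableAt]
      exact h1.comp w (mdifferentiableAt_atlas_symm (chart_mem_atlas ℂ x) h2)
  have hcd := mdifferentiableAt_atlas (I := 𝓘(ℂ)) (chart_mem_atlas ℂ x) hxs
  refine (hd.mdifferentiableAt.comp x hcd).congr_of_eventuallyEq ?_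
  filter_upwards [c.open_source.mem_nhds hxs] with y hy
  exact congrArg T (c.left_inv hy).symm

variable {E : Type u} [TopologicalSpace E] {Y : Type v} [TopologicalSpace Y] [ChartedSpace ℂ Y]

/-- A root chart for `ψ : E → Y` is a complex coordinate on an open subset of `E` some power of
which is the composition of `ψ` with a preferred chart of `Y`, centred at some point. -/
def IsRootChart (ψ : E → Y) (φ : OpenPartialHomeomorph E ℂ) : Prop :=
  ∃ (m : ℕ) (y₀ : Y), m ≠ 0 ∧ ∀ e ∈ φ.source, ψ e ∈ (chartAt ℂ y₀).source ∧
    φ e ^ m = chartAt ℂ y₀ (ψ e) - chartAt ℂ y₀ y₀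

/-- The charted space structure whose atlas consists of all root charts for `ψ`. -/
noncomputable abbrev rootChartedSpace {ψ : E → Y}
    (h : ∀ e, ∃ φ, IsRootChart ψ φ ∧ e ∈ φ.source) : ChartedSpace ℂ E where
  atlas := {φ | IsRootChart ψ φ}
  chartAt e := (h e).choose
  mem_chart_source e := (h e).choose_spec.2
  chart_mem_atlas e := (h e).choose_spec.1

variable [IsManifold 𝓘(ℂ) ω Y] {ψ : E → Y}

/-- Changes of root charts are continuous roots of holomorphic functions, hence holomorphic. -/
theorem isManifold_rootChartedSpace (h : ∀ e, ∃ φ, IsRootChart ψ φ ∧ e ∈ φ.source) :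
    letI := rootChartedSpace h
    IsManifold 𝓘(ℂ) ω E := by
  let _ := rootChartedSpace h
  apply isManifold_of_contDiffOn
  rintro φ φ' ⟨m, y, hm, hφ⟩ ⟨m', y', hm', hφ'⟩
  simp only [mfld_simps]
  set s : Set ℂ := φ.target ∩ φ.symm ⁻¹' φ'.source
  have hs : IsOpen s := φ.symm.isOpen_inter_preimage φ'.open_source
  refine ContDiffOn.congr (f := fun w => φ' (φ.symm w)) ?_ fun _ _ => rfl
  refine AnalyticOn.contDiffOn ?_ hs.uniqueDiffOn
  refine DifferentiableOn.analyticOn (fun w hw => DifferentiableAt.differentiableWithinAt ?_) hs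
  set d := chartAt ℂ y
  set d' := chartAt ℂ y'
  have hψ : ∀ v ∈ s, v ^ m + d y ∈ d.target ∧ ψ (φ.symm v) = d.symm (v ^ m + d y) := by
    intro v hv
    have h1 := hφ _ (φ.map_target hv.1)
    rw [φ.right_inv hv.1] at h1
    rw [h1.2, sub_add_cancel, d.left_inv h1.1]
    exact ⟨d.map_source h1.1, rfl⟩
  refine differentiableAt_of_pow (F := fun v => d' (d.symm (v ^ m + d y)) - d' y') hm' ?_ ?_ ?_
  · filter_upwards [hs.mem_nhds hw] with v hv
    exact ContinuousAt.comp (φ'.continuousAt hv.2) (φ.continuousAt_symm hv.1)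
  · filter_upwards [hs.mem_nhds hw] with v hv
    refine DifferentiableAt.sub_const ?_ _
    rw [← mdifferentiableAt_iff_differentiableAt]
    have h1 : MDifferentiableAt 𝓘(ℂ) 𝓘(ℂ) (fun v : ℂ => v ^ m + d y) v :=
      (by fun_prop : DifferentiableAt ℂ (fun v : ℂ => v ^ m + d y) v).mdifferentiableAt
    have h2 := mdifferentiableAt_atlas_symm (I := 𝓘(ℂ)) (chart_mem_atlas ℂ y) (hψ v hv).1
    have h3 := mdifferentiableAt_atlas (I := 𝓘(ℂ)) (chart_mem_atlas ℂ y')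
      (x := d.symm (v ^ m + d y)) ((hψ v hv).2 ▸ (hφ' _ hv.2).1)
    exact h3.comp v (h2.comp v h1)
  · filter_upwards [hs.mem_nhds hw] with v hv
    rw [(hφ' _ hv.2).2, (hψ v hv).2]

theorem mdifferentiable_rootChartedSpace (h : ∀ e, ∃ φ, IsRootChart ψ φ ∧ e ∈ φ.source) :
    letI := rootChartedSpace h
    MDifferentiable 𝓘(ℂ) 𝓘(ℂ) ψ := by
  let _ := rootChartedSpace h
  have := isManifold_rootChartedSpace h
  intro e
  set φ := chartAt ℂ e
  have he : e ∈ φ.source := mem_chart_source ℂ e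
  obtain ⟨m, y, hm, hφ⟩ : IsRootChart ψ φ := chart_mem_atlas ℂ e
  set d := chartAt ℂ y
  have hval : ∀ e' ∈ φ.source, φ e' ^ m + d y ∈ d.target ∧ ψ e' = d.symm (φ e' ^ m + d y) := by
    intro e' he'
    have h1 := hφ _ he'
    rw [h1.2, sub_add_cancel, d.left_inv h1.1]
    exact ⟨d.map_source h1.1, rfl⟩
  have h1 : MDifferentiableAt 𝓘(ℂ) 𝓘(ℂ) (fun v : ℂ => v ^ m + d y) (φ e) :=
    (by fun_prop : DifferentiableAt ℂ (fun v : ℂ => v ^ m + d y) (φ e)).mdifferentiableAt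
  have h2 := mdifferentiableAt_atlas_symm (I := 𝓘(ℂ)) (chart_mem_atlas ℂ y) (hval e he).1
  have h3 := mdifferentiableAt_atlas (I := 𝓘(ℂ)) (chart_mem_atlas ℂ e) he
  refine (h2.comp e (h1.comp e h3)).congr_of_eventuallyEq ?_
  filter_upwards [φ.open_source.mem_nhds he] with e' he'
  exact (hval e' he').2

/-- A continuous lift through `ψ` of a holomorphic map is holomorphic. -/
theorem mdifferentiable_of_comp_rootChartedSpace
    (h : ∀ e, ∃ φ, IsRootChart ψ φ ∧ e ∈ φ.source)
    {X : Type*} [TopologicalSpace X] [ChartedSpace ℂ X] [IsManifold 𝓘(ℂ) ω X] {π : X → E}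
    (hπ : Continuous π) (hψπ : MDifferentiable 𝓘(ℂ) 𝓘(ℂ) (ψ ∘ π)) :
    letI := rootChartedSpace h
    MDifferentiable 𝓘(ℂ) 𝓘(ℂ) π := by
  let _ := rootChartedSpace h
  have := isManifold_rootChartedSpace h
  intro x
  set φ := chartAt ℂ (π x)
  have hx : π x ∈ φ.source := mem_chart_source ℂ (π x)
  obtain ⟨m, y, hm, hφ⟩ : IsRootChart ψ φ := chart_mem_atlas ℂ (π x)
  set d := chartAt ℂ y
  have hev : ∀ᶠ x' in 𝓝 x, π x' ∈ φ.source := hπ.continuousAt (φ.open_source.mem_nhds hx)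
  have hT : MDifferentiableAt 𝓘(ℂ) 𝓘(ℂ) (φ ∘ π) x := by
    refine mdifferentiableAt_of_pow (G := fun x' => d (ψ (π x')) - d y) hm ?_ ?_ ?_
    · filter_upwards [hev] with x' hx'
      exact ContinuousAt.comp (φ.continuousAt hx') hπ.continuousAt
    · filter_upwards [hev] with x' hx'
      have h1 := mdifferentiableAt_atlas (I := 𝓘(ℂ)) (chart_mem_atlas ℂ y) (hφ _ hx').1
      have h2 : MDifferentiableAt 𝓘(ℂ) 𝓘(ℂ) (fun v : ℂ => v - d y) (d (ψ (π x'))) :=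
        (by fun_prop : DifferentiableAt ℂ (fun v : ℂ => v - d y) _).mdifferentiableAt
      exact h2.comp x' (h1.comp x' (hψπ x'))
    · filter_upwards [hev] with x' hx'
      exact (hφ _ hx').2
  have h3 := mdifferentiableAt_atlas_symm (I := 𝓘(ℂ)) (chart_mem_atlas ℂ (π x)) (φ.map_source hx)
  refine (h3.comp x hT).congr_of_eventuallyEq ?_
  filter_upwards [hev] with x' hx'
  exact (φ.left_inv hx').symm

end RootCharts

/-! ### The branched quotient -/

/-- A chart of a quotient: an open continuous function `u` on an open set `U` whose level sets are
the traces on `U` of the fibres of `π` descends to a local homeomorphism. -/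
theorem exists_openPartialHomeomorph_of_isOpenQuotientMap {C E : Type*} [TopologicalSpace C]
    [TopologicalSpace E] {π : C → E} (hπ : IsOpenQuotientMap π) {U : Set C} (hU : IsOpen U)
    (hne : U.Nonempty) {u : C → ℂ} (hu : ContinuousOn u U)
    (huo : ∀ V ⊆ U, IsOpen V → IsOpen (u '' V))
    (hker : ∀ x ∈ U, ∀ y ∈ U, π x = π y ↔ u x = u y) :
    ∃ φ : OpenPartialHomeomorph E ℂ, φ.source = π '' U ∧ ∀ x ∈ U, φ (π x) = u x := by
  classical
  obtain ⟨x₀, hx₀⟩ := hne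
  have : Nonempty E := ⟨π x₀⟩
  have hex : ∃ κ : E → ℂ, ∀ x ∈ U, κ (π x) = u x := by
    refine ⟨fun e => if h : ∃ x ∈ U, π x = e then u h.choose else 0, fun x hx => ?_⟩
    have h : ∃ y ∈ U, π y = π x := ⟨x, hx, rfl⟩
    simp only [dif_pos h]
    exact (hker _ h.choose_spec.1 _ hx).1 h.choose_spec.2
  obtain ⟨κ, hκ⟩ := hex
  have hinj : InjOn κ (π '' U) := by
    rintro _ ⟨x, hx, rfl⟩ _ ⟨y, hy, rfl⟩ h
    rw [hκ x hx, hκ y hy] at h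
    exact (hker x hx y hy).2 h
  have hsrc : IsOpen (π '' U) := hπ.isOpenMap U hU
  have himg : ∀ W ⊆ π '' U, κ '' W = u '' (U ∩ π ⁻¹' W) := by
    intro W hW
    ext z
    constructor
    · rintro ⟨e, he, rfl⟩
      obtain ⟨x, hx, rfl⟩ := hW he
      exact ⟨x, ⟨hx, he⟩, (hκ x hx).symm⟩
    · rintro ⟨x, ⟨hx, he⟩, rfl⟩
      exact ⟨π x, he, hκ x hx⟩
  have hopen : ∀ W ⊆ π '' U, IsOpen W → IsOpen (κ '' W) := by
    intro W hW hWo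
    rw [himg W hW]
    exact huo _ inter_subset_left (hU.inter (hWo.preimage hπ.continuous))
  have hcont : ContinuousOn κ (π '' U) := by
    rw [continuousOn_open_iff hsrc]
    intro O hO
    have : π '' U ∩ κ ⁻¹' O = π '' (U ∩ u ⁻¹' O) := by
      ext e
      constructor
      · rintro ⟨⟨x, hx, rfl⟩, he⟩
        exact ⟨x, ⟨hx, by rwa [mem_preimage, hκ x hx] at he⟩, rfl⟩
      · rintro ⟨x, ⟨hx, hxO⟩, rfl⟩
        exact ⟨⟨x, hx, rfl⟩, by rwa [mem_preimage, hκ x hx]⟩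
    rw [this]
    exact hπ.isOpenMap _ (hu.isOpen_inter_preimage hU hO)
  have hrestr : IsOpenMap ((hinj.toPartialEquiv κ _).source.domRestrict
      (hinj.toPartialEquiv κ _)) := by
    intro W hW
    have : (π '' U).domRestrict κ '' W = κ '' (Subtype.val '' W) := by
      rw [← image_comp]
      rfl
    change IsOpen ((π '' U).domRestrict κ '' W)
    rw [this]
    exact hopen _ (by rintro _ ⟨w, -, rfl⟩; exact w.2) (hsrc.isOpenMap_subtype_val W hW)
  exact ⟨OpenPartialHomeomorph.ofContinuousOpenRestrict (hinj.toPartialEquiv κ _) hcont hrestr hsrc,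
    rfl, hκ⟩

section Quotient

variable {C : Type u} [TopologicalSpace C] {Y : Type*} [TopologicalSpace Y] [ChartedSpace ℂ Y]
  {R : Type*} [TopologicalSpace R] {Z : Type*}

/-- The pairs of points of `C` with the same images under `q` and `h`, at which `a` is unramified.
Here `h : C → R` and `a : R → Z`. -/
def regularPairs (q : C → Y) (h : C → R) (a : R → Z) : Set (C × C) :=
  {p | q p.1 = q p.2 ∧ h p.1 = h p.2 ∧ IsLocallyInjectiveAt a (h p.1)}

/-- Hypotheses on a commutative square `a ∘ h = g ∘ q` under which the normalized fibre product of
`a` and `g` can be recovered from `C`: near each point of `C` the map `q` is a power of a local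
coordinate, and `h` avoids the ramification points of `a` except at the centre. -/
structure IsBranchedSquare (q : C → Y) (h : C → R) (a : R → Z) (g : Y → Z) : Prop where
  continuous_left : Continuous q
  continuous_right : Continuous h
  comm : ∀ c, a (h c) = g (q c)
  exists_chart : ∀ c, ∀ W ∈ 𝓝 c, ∃ P : PowerChart q c, P.coord.source ⊆ W ∧
    ∀ x ∈ P.coord.source, x ≠ c → IsLocallyInjectiveAt a (h x)

theorem PowerChart.apply_eq_iff_of_eq {q : C → Y} {c c' : C} (P : PowerChart q c)
    (P' : PowerChart q c') (hc : q c = q c') {x y : C} (hx : x ∈ P.coord.source)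
    (hy : y ∈ P'.coord.source) :
    q x = q y ↔ P.coord x ^ P.exponent = P'.coord y ^ P'.exponent := by
  have h1 := P'.pow_eq y hy
  have h2 := P'.mem_chart y hy
  rw [← hc] at h1 h2
  rw [P.pow_eq x hx, h1, sub_left_inj]
  exact ((chartAt ℂ (q c)).injOn.eq_iff (P.mem_chart x hx) h2).symm

theorem PowerChart.exists_ne {q : C → Y} {c : C} (P : PowerChart q c) {W : Set C} (hW : W ∈ 𝓝 c) :
    ∃ x ∈ W, x ∈ P.coord.source ∧ x ≠ c := by
  have hct : Tendsto P.coord.symm (𝓝 0) (𝓝 c) := by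
    have := P.coord.continuousAt_symm (P.coord.map_source P.mem_source)
    rwa [ContinuousAt, P.coord.left_inv P.mem_source, P.coord_center] at this
  have h0 : P.coord.target ∈ 𝓝 (0 : ℂ) := by
    rw [P.target_eq]
    exact Metric.ball_mem_nhds _ P.radius_pos
  have hev : ∀ᶠ w in 𝓝[≠] (0 : ℂ), P.coord.symm w ∈ W ∧ w ∈ P.coord.target ∧ w ≠ 0 := by
    filter_upwards [(hct.eventually hW).filter_mono nhdsWithin_le_nhds,
      mem_nhdsWithin_of_mem_nhds h0, self_mem_nhdsWithin] with w h1 h2 h3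
    exact ⟨h1, h2, h3⟩
  obtain ⟨w, hw, hwt, hw0⟩ := hev.exists
  have hs := P.coord.map_target hwt
  refine ⟨_, hw, hs, fun h => hw0 ?_⟩
  rw [← P.coord_eq_zero_iff hs, P.coord.right_inv hwt] at h
  exact h

namespace IsBranchedSquare

variable {q : C → Y} {h : C → R} {a : R → Z} {g : Y → Z}

/-- Continuation of a coincidence. Let `c`, `c'` have the same image under `q`, and let `x₀`, `y₀`
be points near `c` and `c'` with the same images under `q` and `h`. When `x₀` moves to `x` along a
path in the punctured disc about `c`, the point `y₀` moves to a point with the same images as `x`.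
The paths are parametrized by the logarithm `v` of the coordinate at `c`. -/
theorem continuation [T2Space R] (H : IsBranchedSquare q h a g) {c c' : C} (P : PowerChart q c)
    (hP : ∀ x ∈ P.coord.source, x ≠ c → IsLocallyInjectiveAt a (h x)) (P' : PowerChart q c')
    (hc : q c = q c') {x₀ y₀ : C} (hx₀ : x₀ ∈ P.coord.source) (hx₀c : x₀ ≠ c)
    (hy₀ : y₀ ∈ P'.coord.source) (hq₀ : q x₀ = q y₀) (hh₀ : h x₀ = h y₀)
    {x : C} (hx : x ∈ P.coord.source) (hxc : x ≠ c)
    (hxr : ‖P.coord x‖ ^ P.exponent < P'.radius ^ P'.exponent) :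
    P'.coord y₀ * Complex.exp (P.exponent / P'.exponent *
        (Complex.log (P.coord x) - Complex.log (P.coord x₀))) ∈ P'.coord.target ∧
      q x = q (P'.coord.symm (P'.coord y₀ * Complex.exp (P.exponent / P'.exponent *
        (Complex.log (P.coord x) - Complex.log (P.coord x₀))))) ∧
      h x = h (P'.coord.symm (P'.coord y₀ * Complex.exp (P.exponent / P'.exponent *
        (Complex.log (P.coord x) - Complex.log (P.coord x₀))))) := by
  have hn' : (P'.exponent : ℂ) ≠ 0 := Nat.cast_ne_zero.2 P'.exponent_ne_zero
  have ht₀ : P.coord x₀ ≠ 0 := mt (P.coord_eq_zero_iff hx₀).1 hx₀c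
  have ht : P.coord x ≠ 0 := mt (P.coord_eq_zero_iff hx).1 hxc
  have hpow₀ := (P.apply_eq_iff_of_eq P' hc hx₀ hy₀).1 hq₀
  set v₀ := Complex.log (P.coord x₀) with hv₀
  -- the coordinate of the moving companion of the point with coordinate `exp v`
  set η : ℂ → ℂ := fun v => P'.coord y₀ * Complex.exp (P.exponent / P'.exponent * (v - v₀)) with hη
  have hηpow : ∀ v, Complex.exp v ^ P.exponent = η v ^ P'.exponent := by
    intro v
    rw [hη]
    simp only
    rw [mul_pow, ← hpow₀, ← Complex.exp_nat_mul, ← Complex.exp_nat_mul]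
    conv_rhs => rw [← Complex.exp_log ht₀, ← Complex.exp_nat_mul, ← Complex.exp_add, ← hv₀]
    congr 1
    field_simp
    ring
  -- the logarithms `v` for which `exp v` and `η v` lie in the respective discs form a half-plane
  set I : Set ℝ := {s | Real.exp s < P.radius ∧ Real.exp s ^ P.exponent < P'.radius ^ P'.exponent}
  have hI : Convex ℝ I := by
    have : IsLowerSet I := by
      intro s s' hs hss
      have hle := Real.exp_le_exp.2 hs
      exact ⟨hle.trans_lt hss.1, (pow_le_pow_left₀ (Real.exp_pos _).le hle _).trans_lt hss.2⟩
    exact this.ordConnected.convex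
  set D : Set ℂ := Complex.re ⁻¹' I
  have hD : IsPreconnected D := (hI.linear_preimage Complex.reLm).isPreconnected
  have hDmem : ∀ {v}, v ∈ D ↔ ‖Complex.exp v‖ < P.radius ∧
      ‖Complex.exp v‖ ^ P.exponent < P'.radius ^ P'.exponent := by
    intro v
    rw [Complex.norm_exp]
    rfl
  have hDP : ∀ v ∈ D, Complex.exp v ∈ P.coord.target := fun v hv =>
    P.mem_target_iff.2 (hDmem.1 hv).1
  have hDP' : ∀ v ∈ D, η v ∈ P'.coord.target := fun v hv => by
    rw [P'.mem_target_iff]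
    have h1 := (hDmem.1 hv).2
    rw [← norm_pow, hηpow, norm_pow] at h1
    exact lt_of_pow_lt_pow_left₀ _ P'.radius_pos.le h1
  have hqq : ∀ v ∈ D, q (P.coord.symm (Complex.exp v)) = q (P'.coord.symm (η v)) := fun v hv => by
    rw [P.apply_eq_iff_of_eq P' hc (P.coord.map_target (hDP v hv))
        (P'.coord.map_target (hDP' v hv)),
      P.coord.right_inv (hDP v hv), P'.coord.right_inv (hDP' v hv), hηpow]
  have hv₀D : v₀ ∈ D := by
    rw [hDmem, Complex.exp_log ht₀]
    refine ⟨P.norm_coord_lt hx₀, ?_⟩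
    rw [← norm_pow, hpow₀, norm_pow]
    exact pow_lt_pow_left₀ (P'.norm_coord_lt hy₀) (norm_nonneg _) P'.exponent_ne_zero
  have hvD : Complex.log (P.coord x) ∈ D := by
    rw [hDmem, Complex.exp_log ht]
    exact ⟨P.norm_coord_lt hx, hxr⟩
  have : PreconnectedSpace D := Subtype.preconnectedSpace hD
  have hηc : Continuous η := by fun_prop
  have hlift := eq_of_comp_eq_of_isLocallyInjectiveAt (W := D) (a := a)
    (h₁ := fun v => h (P.coord.symm (Complex.exp v))) (h₂ := fun v => h (P'.coord.symm (η v)))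
    (H.continuous_right.comp (P.coord.continuousOn_symm.comp_continuous
      (Complex.continuous_exp.comp continuous_subtype_val) fun v => hDP v v.2))
    (H.continuous_right.comp (P'.coord.continuousOn_symm.comp_continuous
      (hηc.comp continuous_subtype_val) fun v => hDP' v v.2))
    (fun v => by
      rw [H.comm, H.comm, hqq v v.2])
    (fun v => hP _ (P.coord.map_target (hDP v v.2)) fun h0 => by
      have := (P.coord_eq_zero_iff (P.coord.map_target (hDP v v.2))).2 h0
      rw [P.coord.right_inv (hDP v v.2)] at this
      exact Complex.exp_ne_zero _ this)
    (w₀ := ⟨v₀, hv₀D⟩)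
    (by
      have h1 : η v₀ = P'.coord y₀ := by simp [hη]
      simp only [h1]
      rw [hv₀, Complex.exp_log ht₀, P.coord.left_inv hx₀, P'.coord.left_inv hy₀, hh₀])
    ⟨_, hvD⟩
  have hqx := hqq _ hvD
  simp only at hlift
  rw [Complex.exp_log ht, P.coord.left_inv hx] at hlift hqx
  exact ⟨hDP' _ hvD, hqx, hlift⟩

theorem eq_of_mem_closure [T2Space R] [T2Space Y] (H : IsBranchedSquare q h a g) {c c' : C}
    (hcc : (c, c') ∈ closure (regularPairs q h a)) : q c = q c' ∧ h c = h c' := by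
  have hcl : IsClosed ({p : C × C | q p.1 = q p.2} ∩ {p | h p.1 = h p.2}) :=
    (isClosed_eq (H.continuous_left.comp continuous_fst)
      (H.continuous_left.comp continuous_snd)).inter
    (isClosed_eq (H.continuous_right.comp continuous_fst)
      (H.continuous_right.comp continuous_snd))
  have hsub : regularPairs q h a ⊆ {p : C × C | q p.1 = q p.2} ∩ {p | h p.1 = h p.2} :=
    fun p hp => ⟨hp.1, hp.2.1⟩
  exact closure_minimal hsub hcl hcc

/-- If `(c, c')` is a limit of regular pairs, then every point near `c` forms a regular pair with
a point near `c'`. -/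
theorem eventually_exists_regularPair [T2Space R] [T2Space Y] (H : IsBranchedSquare q h a g)
    {c c' : C} (hcc : (c, c') ∈ closure (regularPairs q h a)) {W : Set C} (hW : W ∈ 𝓝 c') :
    ∀ᶠ x in 𝓝 c, x ≠ c → ∃ y ∈ W, (x, y) ∈ regularPairs q h a := by
  have hqc : q c = q c' := (H.eq_of_mem_closure hcc).1
  obtain ⟨P, -, hP⟩ := H.exists_chart c univ univ_mem
  obtain ⟨P', hP'W, -⟩ := H.exists_chart c' W hW
  -- at a regular pair of centres the local injectivity of `a` suffices; otherwise some nearby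
  -- regular pair lies in the punctured discs and can be continued
  by_cases hreg : (c, c') ∈ regularPairs q h a
  · obtain ⟨-, hhc, hinj⟩ := hreg
    simp only at hhc hinj
    obtain ⟨U, hU, hUi⟩ := hinj
    have hWU : W ∩ h ⁻¹' U ∈ 𝓝 c' :=
      inter_mem hW (H.continuous_right.continuousAt (show U ∈ 𝓝 (h c') from hhc ▸ hU))
    obtain ⟨P₁, hP₁, -⟩ := H.exists_chart c' _ hWU
    have h1 : ∀ᶠ x in 𝓝 c, q x ∈ q '' P₁.coord.source :=
      H.continuous_left.continuousAt (hqc ▸ P₁.image_source_mem_nhds)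
    filter_upwards [h1, H.continuous_right.continuousAt hU, P.source_mem_nhds] with x hx hxU hxP hxc
    obtain ⟨y, hy, hyx⟩ := hx
    refine ⟨y, (hP₁ hy).1, hyx.symm, hUi hxU (hP₁ hy).2 ?_, hP x hxP hxc⟩
    rw [H.comm, H.comm, hyx]
  · obtain ⟨⟨x₀, y₀⟩, ⟨hx₀, hy₀⟩, hq₀, hh₀, hinj₀⟩ :=
      mem_closure_iff_nhds.1 hcc _ (prod_mem_nhds P.source_mem_nhds P'.source_mem_nhds)
    have hx₀c : x₀ ≠ c := by
      rintro rfl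
      have : y₀ = c' := P'.eq_center hy₀ (hq₀.symm.trans hqc)
      exact hreg (this ▸ ⟨hq₀, hh₀, hinj₀⟩)
    have h1 : ∀ᶠ x in 𝓝 c, ‖P.coord x‖ ^ P.exponent < P'.radius ^ P'.exponent := by
      have hcont : ContinuousAt (fun x => ‖P.coord x‖ ^ P.exponent) c :=
        (P.coord.continuousAt P.mem_source).norm.pow _
      refine hcont.eventually (Iio_mem_nhds ?_)
      simp only [P.coord_center, norm_zero, zero_pow P.exponent_ne_zero]
      exact pow_pos P'.radius_pos _
    filter_upwards [h1, P.source_mem_nhds] with x hxr hxP hxc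
    obtain ⟨hmem, hqx, hhx⟩ := H.continuation P hP P' hqc hx₀ hx₀c hy₀ hq₀ hh₀ hxP hxc hxr
    exact ⟨_, hP'W (P'.coord.map_target hmem), hqx, hhx, hP x hxP hxc⟩

/-- The equivalence relation on `C` whose quotient is the normalized fibre product: the closure
of the set of regular pairs. Two points are equivalent if the germs of `(q, h)` at them parametrize
the same local branch. -/
def setoid [T2Space R] [T2Space Y] (H : IsBranchedSquare q h a g) : Setoid C where
  r c c' := (c, c') ∈ closure (regularPairs q h a)
  iseqv :=
    { refl := fun c => by
        rw [mem_closure_iff_nhds]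
        intro N hN
        obtain ⟨W, hW, hWN⟩ := mem_nhds_prod_iff.1 hN
        obtain ⟨W', hW', hWN'⟩ := hWN
        obtain ⟨P, -, hP⟩ := H.exists_chart c univ univ_mem
        obtain ⟨x, hx, hxP, hxc⟩ := P.exists_ne (inter_mem hW hW')
        exact ⟨(x, x), hWN' ⟨hx.1, hx.2⟩, rfl, rfl, hP x hxP hxc⟩
      symm := fun {c c'} hcc => by
        have := map_mem_closure continuous_swap hcc (t := regularPairs q h a)
          fun p hp => ⟨hp.1.symm, hp.2.1.symm, (hp.2.1 ▸ hp.2.2 : IsLocallyInjectiveAt a (h p.2))⟩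
        exact this
      trans := fun {c c' c''} h1 h2 => by
        rw [mem_closure_iff_nhds]
        intro N hN
        obtain ⟨W, hW, W'', hW'', hWN⟩ := mem_nhds_prod_iff.1 hN
        obtain ⟨P, -, hP⟩ := H.exists_chart c univ univ_mem
        have hqc : q c = q c' := (H.eq_of_mem_closure h1).1
        have hev := H.eventually_exists_regularPair h1 (H.eventually_exists_regularPair h2 hW'')
        obtain ⟨x, ⟨hxW, hxev⟩, hxP, hxc⟩ := P.exists_ne (inter_mem hW hev)
        obtain ⟨y, hy, hxy⟩ := hxev hxc
        have hyc : y ≠ c' := by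
          rintro rfl
          exact hxc (P.eq_center hxP (hxy.1.trans hqc.symm))
        obtain ⟨z, hz, hyz⟩ := hy hyc
        exact ⟨(x, z), hWN ⟨hxW, hz⟩, hxy.1.trans hyz.1, hxy.2.1.trans hyz.2.1, hxy.2.2⟩ }

variable [T2Space R] [T2Space Y]

theorem isOpenQuotientMap_mk (H : IsBranchedSquare q h a g) :
    IsOpenQuotientMap (Quotient.mk H.setoid) := by
  refine ⟨Quotient.mk_surjective, continuous_quot_mk, fun W hW => ?_⟩
  refine isQuotientMap_quot_mk.isOpen_preimage.1 ?_
  rw [isOpen_iff_mem_nhds]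
  rintro c' ⟨c, hcW, hcc⟩
  have h1 : (c', c) ∈ closure (regularPairs q h a) := Setoid.symm' H.setoid (Quotient.exact hcc)
  filter_upwards [H.eventually_exists_regularPair h1 (hW.mem_nhds hcW)] with y hy
  by_cases hyc : y = c'
  · exact ⟨c, hcW, hyc ▸ hcc⟩
  · obtain ⟨x, hx, hyx⟩ := hy hyc
    exact ⟨x, hx, Quotient.sound (Setoid.symm' H.setoid (subset_closure hyx))⟩

theorem t2Space_quotient (H : IsBranchedSquare q h a g) : T2Space (Quotient H.setoid) := by
  rw [t2Space_iff_of_isOpenQuotientMap H.isOpenQuotientMap_mk]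
  have : {p : C × C | Quotient.mk H.setoid p.1 = Quotient.mk H.setoid p.2} =
      closure (regularPairs q h a) := by
    ext p
    exact Quotient.eq
  rw [this]
  exact isClosed_closure

/-- The map from the quotient induced by `q`, that is, the projection of the normalized fibre
product. -/
def proj (H : IsBranchedSquare q h a g) : Quotient H.setoid → Y :=
  Quotient.lift q fun _ _ hcc => (H.eq_of_mem_closure hcc).1

/-- On a small disc with coordinate `t` the equivalence relation is that of having the same `t ^ k`
for some `k`. The rotations of the disc that preserve `q` and `h` form a finite group of complex
numbers, hence are the `k`-th roots of unity; by continuation a rotation that preserves `q` and `h`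
at one point of the punctured disc preserves them everywhere. -/
theorem exists_pow_eq_iff (H : IsBranchedSquare q h a g) {c : C} (P : PowerChart q c)
    (hP : ∀ x ∈ P.coord.source, x ≠ c → IsLocallyInjectiveAt a (h x)) :
    ∃ k : ℕ, k ≠ 0 ∧ k ∣ P.exponent ∧ ∀ x ∈ P.coord.source, ∀ y ∈ P.coord.source,
      (x, y) ∈ closure (regularPairs q h a) ↔ P.coord x ^ k = P.coord y ^ k := by
  set t := P.coord
  set n := P.exponent
  have hn : n ≠ 0 := P.exponent_ne_zero
  have : NeZero n := ⟨hn⟩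
  have hnorm : ∀ ζ : ℂˣ, ζ ^ n = 1 → ‖(ζ : ℂ)‖ = 1 := fun ζ hζ =>
    Complex.norm_eq_one_of_pow_eq_one (n := n)
      (by rw [← Units.val_pow_eq_pow_val, hζ, Units.val_one]) hn
  have hrot : ∀ ζ : ℂˣ, ζ ^ n = 1 → ∀ x ∈ t.source, (ζ : ℂ) * t x ∈ t.target := by
    intro ζ hζ x hx
    rw [P.mem_target_iff, norm_mul, hnorm ζ hζ, one_mul]
    exact P.norm_coord_lt hx
  have hrot_ne : ∀ ζ : ℂˣ, ζ ^ n = 1 → ∀ x ∈ t.source, x ≠ c → t.symm (ζ * t x) ≠ c := by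
    intro ζ hζ x hx hxc h0
    have h1 := (P.coord_eq_zero_iff (t.map_target (hrot ζ hζ x hx))).2 h0
    rw [t.right_inv (hrot ζ hζ x hx)] at h1
    exact mul_ne_zero ζ.ne_zero (mt (P.coord_eq_zero_iff hx).1 hxc) h1
  -- the rotations that preserve `q` and `h`
  let G : Subgroup ℂˣ :=
    { carrier := {ζ | ζ ^ n = 1 ∧ ∀ x ∈ t.source, x ≠ c → h (t.symm (ζ * t x)) = h x}
      one_mem' := ⟨one_pow n, fun x hx _ => by rw [Units.val_one, one_mul, t.left_inv hx]⟩
      mul_mem' := by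
        rintro ζ ξ ⟨hζ, hζh⟩ ⟨hξ, hξh⟩
        refine ⟨by rw [mul_pow, hζ, hξ, one_mul], fun x hx hxc => ?_⟩
        have h1 := hζh _ (t.map_target (hrot ξ hξ x hx)) (hrot_ne ξ hξ x hx hxc)
        rw [t.right_inv (hrot ξ hξ x hx), hξh x hx hxc] at h1
        rw [Units.val_mul, mul_assoc, h1]
      inv_mem' := by
        rintro ζ ⟨hζ, hζh⟩
        have hζ' : ζ⁻¹ ^ n = 1 := by rw [inv_pow, hζ, inv_one]
        refine ⟨hζ', fun x hx hxc => ?_⟩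
        have h1 := hζh _ (t.map_target (hrot _ hζ' x hx)) (hrot_ne _ hζ' x hx hxc)
        rw [t.right_inv (hrot _ hζ' x hx), Units.mul_inv_cancel_left, t.left_inv hx] at h1
        exact h1.symm }
  have hGn : G ≤ rootsOfUnity n ℂ := fun ζ hζ => (mem_rootsOfUnity n ζ).2 hζ.1
  have : Finite G := Finite.of_injective _ (Subgroup.inclusion_injective hGn)
  set k := Nat.card G with hk
  have hk0 : k ≠ 0 := Nat.card_pos.ne'
  have : NeZero k := ⟨hk0⟩
  have hkn : k ∣ n := by
    rw [← Complex.card_rootsOfUnity n]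
    exact Subgroup.card_dvd_of_le hGn
  -- by Lagrange `G` consists of `k`-th roots of unity, of which there are at most `k`
  have hGk : G = rootsOfUnity k ℂ := by
    refine Subgroup.eq_of_le_of_card_ge (fun ζ hζ => ?_) (card_rootsOfUnity ℂ k)
    rw [mem_rootsOfUnity]
    exact congrArg Subtype.val (pow_card_eq_one' (x := (⟨ζ, hζ⟩ : G)))
  refine ⟨k, hk0, hkn, fun x hx y hy => ?_⟩
  have htx := P.coord_eq_zero_iff hx
  have hty := P.coord_eq_zero_iff hy
  constructor
  · intro hxy
    obtain ⟨hqxy, hhxy⟩ := H.eq_of_mem_closure hxy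
    by_cases hxc : x = c
    · rw [hxc, P.eq_center hy (hqxy.symm.trans (congrArg q hxc))]
    have hx0 : t x ≠ 0 := mt htx.1 hxc
    have hpow : t x ^ n = t y ^ n := (P.apply_eq_iff hx hy).1 hqxy
    have hy0 : t y ≠ 0 := fun h0 => pow_ne_zero n hx0 (by rw [hpow, h0, zero_pow hn])
    set ζ : ℂˣ := Units.mk0 (t y / t x) (div_ne_zero hy0 hx0) with hζ
    have hζn : ζ ^ n = 1 := by
      ext
      rw [Units.val_pow_eq_pow_val, hζ, Units.val_mk0, div_pow, hpow, div_self (pow_ne_zero n hy0),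
        Units.val_one]
    have hζG : ζ ∈ G := by
      refine ⟨hζn, fun z hz hzc => ?_⟩
      have hz0 : t z ≠ 0 := mt (P.coord_eq_zero_iff hz).1 hzc
      have h1 := (H.continuation P hP P rfl hx hxc hy hqxy hhxy hz hzc
        (pow_lt_pow_left₀ (P.norm_coord_lt hz) (norm_nonneg _) hn)).2.2
      rw [div_self (Nat.cast_ne_zero.2 hn), one_mul, Complex.exp_sub, Complex.exp_log hz0,
        Complex.exp_log hx0] at h1
      rw [h1, hζ, Units.val_mk0]
      congr 2
      change t y / t x * t z = t y * (t z / t x)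
      ring
    rw [hGk, mem_rootsOfUnity] at hζG
    have h1 := congrArg Units.val hζG
    rw [Units.val_pow_eq_pow_val, hζ, Units.val_mk0, Units.val_one, div_pow,
      div_eq_one_iff_eq (pow_ne_zero k hx0)] at h1
    exact h1.symm
  · intro hpow
    by_cases hxc : x = c
    · have h1 : t y = 0 := by
        rw [htx.2 hxc, zero_pow hk0] at hpow
        exact (pow_eq_zero_iff hk0).1 hpow.symm
      rw [hxc, hty.1 h1]
      exact Setoid.refl' H.setoid c
    have hx0 : t x ≠ 0 := mt htx.1 hxc
    have hy0 : t y ≠ 0 := fun h0 => pow_ne_zero k hx0 (by rw [hpow, h0, zero_pow hk0])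
    set ζ : ℂˣ := Units.mk0 (t y / t x) (div_ne_zero hy0 hx0) with hζ
    have hζG : ζ ∈ G := by
      rw [hGk, mem_rootsOfUnity]
      ext
      rw [Units.val_pow_eq_pow_val, hζ, Units.val_mk0, div_pow, hpow, div_self (pow_ne_zero k hy0),
        Units.val_one]
    have h1 := hζG.2 x hx hxc
    rw [hζ, Units.val_mk0, div_mul_cancel₀ _ hx0, t.left_inv hy] at h1
    refine subset_closure ⟨(P.apply_eq_iff hx hy).2 ?_, h1.symm, hP x hx hxc⟩
    obtain ⟨m, hm⟩ := hkn
    change t x ^ n = t y ^ n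
    rw [hm, pow_mul, pow_mul, hpow]

theorem exists_isRootChart (H : IsBranchedSquare q h a g) (e : Quotient H.setoid) :
    ∃ φ, IsRootChart H.proj φ ∧ e ∈ φ.source := by
  obtain ⟨c, rfl⟩ := Quotient.mk_surjective e
  obtain ⟨P, -, hP⟩ := H.exists_chart c univ univ_mem
  obtain ⟨k, hk0, ⟨m, hkm⟩, hker⟩ := H.exists_pow_eq_iff P hP
  have : NeZero k := ⟨hk0⟩
  obtain ⟨φ, hφs, hφ⟩ := exists_openPartialHomeomorph_of_isOpenQuotientMap H.isOpenQuotientMap_mk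
    P.coord.open_source ⟨c, P.mem_source⟩ (u := fun x => P.coord x ^ k)
    (P.coord.continuousOn.pow k)
    (fun V hV hVo => by
      have h1 := (Complex.isOpenQuotientMap_pow k).isOpenMap _
        (P.coord.isOpen_image_of_subset_source hVo hV)
      rwa [← image_comp] at h1)
    fun x hx y hy => Quotient.eq.trans (hker x hx y hy)
  refine ⟨φ, ⟨m, q c, ?_, ?_⟩, hφs ▸ ⟨c, P.mem_source, rfl⟩⟩
  · rintro rfl
    exact P.exponent_ne_zero hkm
  · intro e he
    rw [hφs] at he
    obtain ⟨x, hx, rfl⟩ := he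
    refine ⟨P.mem_chart x hx, ?_⟩
    rw [hφ x hx, ← pow_mul, ← hkm]
    exact P.pow_eq x hx

end IsBranchedSquare

end Quotient

/-! ### Factorizations and irreducible pairs -/

theorem IsNonconstantHolomorphic.comp {X Y Z : Type*} [TopologicalSpace X] [ChartedSpace ℂ X]
    [TopologicalSpace Y] [ChartedSpace ℂ Y] [TopologicalSpace Z] [ChartedSpace ℂ Z] {a : Y → Z}
    {b : X → Y} (ha : IsNonconstantHolomorphic a) (hb : IsNonconstantHolomorphic b)
    (hsurj : Function.Surjective b) : IsNonconstantHolomorphic (a ∘ b) := by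
  refine ⟨ha.mdifferentiable.comp hb.mdifferentiable, ?_⟩
  rintro ⟨z, hz⟩
  refine ha.nonconstant ⟨z, fun y => ?_⟩
  obtain ⟨x, rfl⟩ := hsurj y
  exact hz x

theorem isBranchedSquare_of_isNonconstantHolomorphic {C Y R Z : Type*}
    [TopologicalSpace C] [ChartedSpace ℂ C] [CompactRiemannSurface C]
    [TopologicalSpace Y] [ChartedSpace ℂ Y] [CompactRiemannSurface Y]
    [TopologicalSpace R] [ChartedSpace ℂ R] [CompactRiemannSurface R]
    [TopologicalSpace Z] [ChartedSpace ℂ Z] [CompactRiemannSurface Z]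
    {q : C → Y} {h : C → R} {a : R → Z} {g : Y → Z} (hq : IsNonconstantHolomorphic q)
    (hh : IsNonconstantHolomorphic h) (ha : IsNonconstantHolomorphic a)
    (hcomm : ∀ c, a (h c) = g (q c)) : IsBranchedSquare q h a g where
  continuous_left := hq.continuous
  continuous_right := hh.continuous
  comm := hcomm
  exists_chart c W hW := by
    have hfin : (h ⁻¹' {r | ¬ IsLocallyInjectiveAt a r}).Finite :=
      ha.finite_ramification.preimage' fun r _ => hh.finite_fiber r
    have hN : (h ⁻¹' {r | ¬ IsLocallyInjectiveAt a r} \ {c})ᶜ ∈ 𝓝 c :=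
      (hfin.subset sdiff_subset).isClosed.isOpen_compl.mem_nhds (by simp)
    obtain ⟨P, hP⟩ := hq.exists_powerChart c (inter_mem hW hN)
    exact ⟨P, fun x hx => (hP hx).1, fun x hx hxc => by_contra fun hr => (hP hx).2 ⟨hr, hxc⟩⟩

/-- If a decomposition `q = proj ∘ mk` through the normalized fibre product is trivial because `q`
is indecomposable, then the projection or the quotient map is injective. -/
theorem IsIndecomposable.injective_proj_or_injective_mk {C Y R : Type u} {Z : Type v}
    [TopologicalSpace C] [ChartedSpace ℂ C] [CompactRiemannSurface C]
    [TopologicalSpace Y] [ChartedSpace ℂ Y] [CompactRiemannSurface Y]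
    [TopologicalSpace R] [T2Space R]
    {q : C → Y} {h : C → R} {a : R → Z} {g : Y → Z} (hq : IsNonconstantHolomorphic q)
    (hind : IsIndecomposable q) (H : IsBranchedSquare q h a g) :
    Function.Injective H.proj ∨ Function.Injective (Quotient.mk H.setoid) := by
  let _ : ChartedSpace ℂ (Quotient H.setoid) := rootChartedSpace H.exists_isRootChart
  have : IsManifold 𝓘(ℂ) ω (Quotient H.setoid) := isManifold_rootChartedSpace H.exists_isRootChart
  have : T2Space (Quotient H.setoid) := H.t2Space_quotient
  have : CompactRiemannSurface (Quotient H.setoid) := { }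
  have hfac : q = H.proj ∘ Quotient.mk H.setoid := rfl
  have hproj : IsNonconstantHolomorphic H.proj := by
    refine ⟨mdifferentiable_rootChartedSpace H.exists_isRootChart, ?_⟩
    rintro ⟨y, hy⟩
    exact hq.nonconstant ⟨y, fun c => hy (Quotient.mk H.setoid c)⟩
  have hmk : IsNonconstantHolomorphic (Quotient.mk H.setoid) := by
    refine ⟨mdifferentiable_of_comp_rootChartedSpace H.exists_isRootChart continuous_quot_mk
      hq.mdifferentiable, ?_⟩
    rintro ⟨e, he⟩
    exact hq.nonconstant ⟨H.proj e, fun c => congrArg H.proj (he c)⟩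
  rw [← hproj.degree_eq_one_iff, ← hmk.degree_eq_one_iff]
  exact hind.degree_eq_one (Quotient H.setoid) _ _ hproj hmk hfac

/-- For an irreducible pair `f`, `g`, the image of `C` in the fibre product contains all points over
the base point: it is closed, it is open off the critical values of `f`, and the monodromy connects
any two points over the base point. -/
theorem exists_preimage_of_orbitCount_eq_one {C X Y Z : Type*}
    [TopologicalSpace C] [ChartedSpace ℂ C] [CompactRiemannSurface C]
    [TopologicalSpace X] [ChartedSpace ℂ X] [CompactRiemannSurface X]
    [TopologicalSpace Y] [ChartedSpace ℂ Y] [CompactRiemannSurface Y]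
    [TopologicalSpace Z] [ChartedSpace ℂ Z] [CompactRiemannSurface Z]
    {f : X → Z} {g : Y → Z} {p : C → X} {q : C → Y}
    (hf : IsNonconstantHolomorphic f) (hp : IsNonconstantHolomorphic p)
    (hq : IsNonconstantHolomorphic q) (hcomm : ∀ c, f (p c) = g (q c)) {z₀ : Z}
    (hz₀ : z₀ ∉ branchPoints f ∪ branchPoints g)
    (hone : orbitCount f g (branchPoints f ∪ branchPoints g) hz₀ = 1)
    {x : X} {y : Y} (hx : f x = z₀) (hy : g y = z₀) : ∃ c, p c = x ∧ q c = y := by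
  obtain ⟨x₀, hx₀⟩ := hf.surjective z₀
  obtain ⟨c₀, rfl⟩ := hp.surjective x₀
  obtain ⟨hsub, -⟩ := Nat.card_eq_one_iff_unique.1 hone
  obtain ⟨γ, hγ, ⟨α, hα⟩, ⟨β, hβ⟩⟩ : (pairMonodromy f g _ hz₀).r
      (⟨p c₀, hx₀⟩, ⟨q c₀, (hcomm c₀).symm.trans hx₀⟩) (⟨x, hx⟩, ⟨y, hy⟩) :=
    Quotient.exact (hsub.elim _ _)
  set T : Set unitInterval := (fun t => (α t, β t)) ⁻¹' range fun c => (p c, q c)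
  have hcl : IsClosed T :=
    (isCompact_range (hp.continuous.prodMk hq.continuous)).isClosed.preimage
      (α.continuous.prodMk β.continuous)
  have hop : IsOpen T := by
    rw [isOpen_iff_mem_nhds]
    rintro t ⟨c, hc⟩
    obtain ⟨hpc, hqc⟩ : p c = α t ∧ q c = β t := Prod.mk.inj hc
    have hα_inj : IsLocallyInjectiveAt f (α t) := by
      refine isLocallyInjectiveAt_of_mfderiv_ne_zero hf.mdifferentiable fun h0 => hγ t ?_
      exact Or.inl ⟨α t, hα t, h0⟩
    obtain ⟨U, hU, hinj⟩ := hα_inj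
    have hW : p ⁻¹' U ∈ 𝓝 c := hp.continuous.continuousAt (show U ∈ 𝓝 (p c) from hpc ▸ hU)
    have hqW : q '' (p ⁻¹' U) ∈ 𝓝 (β t) := hqc ▸ hq.isOpenMap.image_mem_nhds hW
    filter_upwards [α.continuous.continuousAt hU, β.continuous.continuousAt hqW] with s hs hs'
    obtain ⟨c', hc', hqc'⟩ := hs'
    refine ⟨c', Prod.ext (hinj hc' hs ?_) hqc'⟩
    rw [hcomm, hqc', hα]
    exact hβ s
  have huniv : T = univ :=
    IsClopen.eq_univ ⟨hcl, hop⟩ ⟨0, c₀, Prod.ext α.source.symm β.source.symm⟩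
  obtain ⟨c, hc⟩ : (1 : unitInterval) ∈ T := huniv ▸ mem_univ _
  obtain ⟨hpc, hqc⟩ := Prod.mk.inj hc
  exact ⟨c, hpc.trans α.target, hqc.trans β.target⟩

end Decomposition

open Decomposition in
theorem theorem3p6 {C C₁ C₂ : Type u}
    [TopologicalSpace C] [ChartedSpace ℂ C] [CompactRiemannSurface C]
    [TopologicalSpace C₁] [ChartedSpace ℂ C₁] [CompactRiemannSurface C₁]
    [TopologicalSpace C₂] [ChartedSpace ℂ C₂] [CompactRiemannSurface C₂]
    (f : C₁ → OnePoint ℂ) (g : C₂ → OnePoint ℂ) (p : C → C₁) (q : C → C₂)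
    (hf : IsNonconstantHolomorphic f) (hg : IsNonconstantHolomorphic g)
    (hp : IsNonconstantHolomorphic p) (hq : IsNonconstantHolomorphic q)
    (hf_deg : 1 < degree f)
    (hfg : IsIrreduciblePair f g)
    (hcomm : f ∘ p = g ∘ q)
    (hq_ind : IsIndecomposable q) :
    IsIndecomposable f := by
  refine ⟨hf_deg, fun R _ _ _ a b ha hb hfab => ?_⟩
  obtain ⟨z₀, hz₀, hone⟩ := hfg
  have hfp : ∀ c, f (p c) = g (q c) := congrFun hcomm
  have hab : ∀ x, f x = a (b x) := congrFun hfab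
  have hh : IsNonconstantHolomorphic (b ∘ p) := hb.comp hp hp.surjective
  have H : IsBranchedSquare q (b ∘ p) a g :=
    isBranchedSquare_of_isNonconstantHolomorphic hq hh ha fun c => (hab (p c)).symm.trans (hfp c)
  have hlift : ∀ x y, f x = z₀ → g y = z₀ → ∃ c, p c = x ∧ q c = y := fun x y hx hy =>
    exists_preimage_of_orbitCount_eq_one hf hp hq hfp hz₀ hone hx hy
  have hf_inj : ∀ x, f x = z₀ → IsLocallyInjectiveAt (a ∘ b) x := fun x hx => hfab ▸
    isLocallyInjectiveAt_of_mfderiv_ne_zero hf.mdifferentiable fun h0 => hz₀ (Or.inl ⟨x, hx, h0⟩)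
  obtain ⟨x₀, hx₀⟩ := hf.surjective z₀
  obtain ⟨y₀, hy₀⟩ := hg.surjective z₀
  -- an injective projection of the quotient to `C₂` forces `a` to be injective, and an injective
  -- quotient map forces `b` to be injective
  rcases hq_ind.injective_proj_or_injective_mk hq H with hinj | hinj
  · left
    rw [ha.degree_eq_one_iff]
    refine ha.injective_of_subsingleton_fiber ((hf_inj x₀ hx₀).of_comp_left hb.isOpenMap)
      fun r hr => ?_
    obtain ⟨x, rfl⟩ := hb.surjective r
    rw [← hab, ← hab, hx₀] at hr
    obtain ⟨c, rfl, hqc⟩ := hlift x y₀ hr hy₀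
    obtain ⟨c', rfl, hqc'⟩ := hlift x₀ y₀ hx₀ hy₀
    have h1 : Quotient.mk H.setoid c = Quotient.mk H.setoid c' := hinj (hqc.trans hqc'.symm)
    exact (H.eq_of_mem_closure (Quotient.exact h1)).2
  · right
    rw [hb.degree_eq_one_iff]
    refine hb.injective_of_subsingleton_fiber (hf_inj x₀ hx₀).of_comp_right fun x hx => ?_
    have hxz : f x = z₀ := by rw [hab, hx, ← hab, hx₀]
    obtain ⟨c, rfl, hqc⟩ := hlift x y₀ hxz hy₀
    obtain ⟨c', rfl, hqc'⟩ := hlift x₀ y₀ hx₀ hy₀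
    have ha_inj : IsLocallyInjectiveAt a (b (p c)) := (hf_inj _ hxz).of_comp_left hb.isOpenMap
    have h1 : (c, c') ∈ regularPairs q (b ∘ p) a := ⟨hqc.trans hqc'.symm, hx, ha_inj⟩
    exact congrArg p (hinj (Quotient.sound (subset_closure h1)))
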